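/- Let $G$ be a totally disconnected, locally compact group and let $\alpha\colon G\to G$ be a continuous homomorphism. A sequence in $G$ is called bounded if its set of values has compact closure. An $\alpha$-regressive sequence for $x\in G$ is a sequence $(x_n)_{n\ge 0}$ in $G$ with $x_0=x$ and $\alpha(x_{n+1})=x_n$ for all $n\ge 0$. Define $$\mathrm{par}^+(\alpha)=\{x\in G : (\alpha^n(x))_{n\ge0}\text{ is bounded}\},\qquad \mathrm{par}^-(\alpha)=\{x\in G : x \text{ has a bounded } \alpha\text{-regressive sequence}\}$$ (the parabolic and anti-parabolic subgroups) and $\mathrm{lev}(\alpha)=\mathrm{par}^+(\alpha)\cap\mathrm{par}^-(\alpha)$ (the Levi subgroup). The scale of $\alpha$ is the minimum of the indices $[\alpha(U):\alpha(U)\cap U]$ over all compact open subgroups $U$ of $G$; a compact open subgroup at which the minimum is attained is called minimizing for $\alpha$, and $\mathrm{nub}(\alpha)$ is the intersection of all compact open subgroups of $G$ that are minimizing for $\alpha$. Let $K=\{x\in G : \alpha^n(x)=e\text{ for some }n\ge0\}$ be the iterated kernel, and let the bounded iterated kernel be $$\mathrm{ik}(\alpha)=\overline{K\cap \mathrm{par}^-(\alpha)}.$$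 Then $$\mathrm{ik}(\alpha)\le\mathrm{nub}(\alpha)\le\mathrm{lev}(\alpha),$$ and each of these three subgroups $H$ is $\alpha$-stable, that is, $\alpha(H)=H$. Furthermore, $\mathrm{nub}(\alpha)$ and $\mathrm{ik}(\alpha)$ are compact, $\mathrm{ik}(\alpha)$ is a normal subgroup of $\mathrm{par}^-(\alpha)$, and the endomorphism of the topological group $\mathrm{par}^-(\alpha)/\mathrm{ik}(\alpha)$ induced by $\alpha$ is an automorphism (bijective with continuous inverse). Moreover, the (possibly larger) subgroup $\overline{K}\cap\mathrm{par}^-(\alpha)$, which contains $\mathrm{ik}(\alpha)$, is also contained in $\mathrm{nub}(\alpha)$, is compact, is mapped into itself by $\alpha$, and is normal in $\mathrm{par}^-(\alpha)$. -/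

import Mathlib

namespace Endo

variable {G : Type*} [Group G] [TopologicalSpace G]

/-- A sequence is bounded if its set of values has compact closure. -/
def IsBoundedSeq (u : ℕ → G) : Prop := IsCompact (closure (Set.range u))

/-- `u` is an `α`-regressive sequence for `x`: it starts at `x` and `α (u (n+1)) = u n`. -/
structure IsRegressive (α : G →ₜ* G) (x : G) (u : ℕ → G) : Prop where
  zero : u 0 = x
  succ : ∀ n, α (u (n + 1)) = u n

/-- The displacement index `[α(U) : α(U) ∩ U]` (finite when `U` is compact and open). -/
noncomputable def displacementIndex (α : G →ₜ* G) (U : Subgroup G) : ℕ :=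
  (U.map α.toMonoidHom ⊓ U).relIndex (U.map α.toMonoidHom)

/-- The scale of `α`: the least displacement index of a compact open subgroup. -/
noncomputable def scale (α : G →ₜ* G) : ℕ :=
  sInf {n | ∃ U : Subgroup G,
    IsCompact (U : Set G) ∧ IsOpen (U : Set G) ∧ n = displacementIndex α U}

/-- A compact open subgroup is minimizing if its displacement index is the scale. -/
structure IsMinimizing (α : G →ₜ* G) (U : Subgroup G) : Prop where
  isCompact : IsCompact (U : Set G)
  isOpen : IsOpen (U : Set G)
  index_eq : displacementIndex α U = scale α

/-- The nub: the intersection of all minimizing compact open subgroups. -/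
def nub (α : G →ₜ* G) : Subgroup G := sInf {W | IsMinimizing α W}

/-- A subgroup is `α`-stable if `α` maps it onto itself. -/
def IsStable (α : G →ₜ* G) (H : Subgroup G) : Prop := H.map α.toMonoidHom = H

/-- A subgroup is `α`-invariant if `α` maps it into itself. -/
def IsInvariant (α : G →ₜ* G) (H : Subgroup G) : Prop := H.map α.toMonoidHom ≤ H

lemma iterate_one (α : G →ₜ* G) (n : ℕ) : α^[n] (1 : G) = 1 := iterate_map_one α n

lemma iterate_mul (α : G →ₜ* G) (n : ℕ) (x y : G) : α^[n] (x * y) = α^[n] x * α^[n] y :=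
  iterate_map_mul α n x y

lemma iterate_inv (α : G →ₜ* G) (n : ℕ) (x : G) : α^[n] x⁻¹ = (α^[n] x)⁻¹ :=
  iterate_map_inv α n x

/-- The iterated kernel: the elements that some power of `α` sends to the identity. -/
def iteratedKernel (α : G →ₜ* G) : Subgroup G where
  carrier := {x | ∃ n : ℕ, α^[n] x = 1}
  one_mem' := ⟨0, rfl⟩
  mul_mem' := by
    rintro x y ⟨m, hm⟩ ⟨n, hn⟩
    refine ⟨n + m, ?_⟩
    rw [iterate_mul, Function.iterate_add_apply, hm, iterate_one, Nat.add_comm,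
      Function.iterate_add_apply, hn, iterate_one, one_mul]
  inv_mem' := by
    rintro x ⟨n, hn⟩
    exact ⟨n, by rw [iterate_inv, hn, inv_one]⟩

variable [IsTopologicalGroup G]

lemma IsBoundedSeq.one : IsBoundedSeq (fun _ : ℕ => (1 : G)) := by
  unfold IsBoundedSeq
  rw [Set.range_const]
  exact isCompact_singleton.closure

lemma IsBoundedSeq.mul {u v : ℕ → G} (hu : IsBoundedSeq u) (hv : IsBoundedSeq v) :
    IsBoundedSeq (fun n => u n * v n) := by
  refine (IsCompact.mul hu hv).closure_of_subset ?_
  rintro _ ⟨n, rfl⟩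
  exact Set.mul_mem_mul (subset_closure ⟨n, rfl⟩) (subset_closure ⟨n, rfl⟩)

lemma IsBoundedSeq.inv {u : ℕ → G} (hu : IsBoundedSeq u) : IsBoundedSeq (fun n => (u n)⁻¹) := by
  refine (IsCompact.inv hu).closure_of_subset ?_
  rintro _ ⟨n, rfl⟩
  exact Set.inv_mem_inv.mpr (subset_closure ⟨n, rfl⟩)

/-- The parabolic subgroup: the elements with bounded forward orbit. -/
def parPlus (α : G →ₜ* G) : Subgroup G where
  carrier := {x | IsBoundedSeq (fun n : ℕ => α^[n] x)}
  one_mem' := by simpa only [Set.mem_ofPred_eq, iterate_one] using IsBoundedSeq.one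
  mul_mem' := by
    intro x y hx hy
    simpa only [Set.mem_ofPred_eq, iterate_mul] using IsBoundedSeq.mul hx hy
  inv_mem' := by
    intro x hx
    simpa only [Set.mem_ofPred_eq, iterate_inv] using IsBoundedSeq.inv hx

/-- The anti-parabolic subgroup: the elements with a bounded regressive sequence. -/
def parMinus (α : G →ₜ* G) : Subgroup G where
  carrier := {x | ∃ u : ℕ → G, IsRegressive α x u ∧ IsBoundedSeq u}
  one_mem' := ⟨fun _ => 1, ⟨rfl, fun _ => map_one α⟩, IsBoundedSeq.one⟩
  mul_mem' := by
    rintro x y ⟨u, hu, hub⟩ ⟨v, hv, hvb⟩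
    exact ⟨fun n => u n * v n, ⟨by simp only [hu.zero, hv.zero],
      fun n => by simp only [map_mul, hu.succ, hv.succ]⟩, hub.mul hvb⟩
  inv_mem' := by
    rintro x ⟨u, hu, hub⟩
    exact ⟨fun n => (u n)⁻¹, ⟨by simp only [hu.zero],
      fun n => by simp only [map_inv, hu.succ]⟩, hub.inv⟩

/-- The Levi subgroup. -/
def lev (α : G →ₜ* G) : Subgroup G := parPlus α ⊓ parMinus α

/-- The bounded iterated kernel: the closure of the group of those elements of the iterated
kernel that have a bounded regressive sequence. -/
def ik (α : G →ₜ* G) : Subgroup G := (iteratedKernel α ⊓ parMinus α).topologicalClosure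

lemma map_mem_parMinus (α : G →ₜ* G) {x : G} (hx : x ∈ parMinus α) : α x ∈ parMinus α := by
  obtain ⟨u, hu, hub⟩ := hx
  refine ⟨fun n => α (u n), ⟨by simp only [hu.zero], fun n => by simp only [hu.succ]⟩, ?_⟩
  refine (IsCompact.image hub (map_continuous α)).closure_of_subset ?_
  rintro _ ⟨n, rfl⟩
  exact Set.mem_image_of_mem _ (subset_closure ⟨n, rfl⟩)

/-- The restriction of `α` to its anti-parabolic subgroup. -/
def parMinusHom (α : G →ₜ* G) : parMinus α →* parMinus α :=
  (α.toMonoidHom.comp (parMinus α).subtype).codRestrict (parMinus α)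
    fun x => map_mem_parMinus α x.2

/-- The bounded iterated kernel as a subgroup of the anti-parabolic subgroup. -/
def ikInParMinus (α : G →ₜ* G) : Subgroup (parMinus α) := (ik α).subgroupOf (parMinus α)

end Endo

open Topology
open scoped Pointwise

namespace Endo

/-! ### Subgroups of `U` cut out by forward and regressive trajectories -/

section Subgroups

variable {G : Type*} [Group G] [TopologicalSpace G]

/-! Everything rests on tidy subgroups. A compact open `U` is tidy above when passing to `negTrunc α
U n` does not lower its displacement index; it then factors as `posAll α U` times `negAll α U`. It
is tidy if moreover no orbit starts in `U`, leaves it, and finally returns for good. Tidy and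
minimizing are the same (`isMinimizing_iff_isTidy`), because the index of `U ∩ α⁻ⁿ(U)` in `U`
depends on `U` only up to a factor bounded in `n`.

What obstructs tidiness are the homoclinic elements. They form a relatively compact subgroup
(`exists_homoclinic_subset`) that `α` maps onto itself, and every compact open `O` containing the
closure of such a group contains a tidy subgroup (`exists_isTidy_le`). Hence tidy subgroups exist
and the nub lies in every homoclinic closure. Conversely a minimizing `U` contains its own
homoclinic closure. So the nub is the intersection of a directed family of compact stable groups;
this makes it compact and stable, and compact stable groups lie in `lev α`.

For tidy `U`, `negEv α U` is closed and contains the iterated kernel, while an element of `parMinus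
α` lying in `negEv α U` is already in `U` (`IsTidy.parMinus_inf_negEv_le`). This puts `ik α`, and
the larger group, into the nub. On the quotient by `ik α`, injectivity holds because the kernel of
`α` in `parMinus α` lies in `ik α`, and openness because `U ⊓ parMinus α` is the compact group
`posAll α U`. -/

/-- The iterates of `α` as group homomorphisms. -/
def iterHom (α : G →ₜ* G) (n : ℕ) : G →* G where
  toFun := α^[n]
  map_one' := iterate_one α n
  map_mul' := iterate_mul α n

@[simp] lemma iterHom_apply (α : G →ₜ* G) (n : ℕ) (x : G) : iterHom α n x = α^[n] x := rfl

lemma continuous_iterate (α : G →ₜ* G) (n : ℕ) : Continuous (α^[n]) :=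
  (map_continuous α).iterate n

/-- The elements whose orbit stays in `U` up to time `n`. -/
def negTrunc (α : G →ₜ* G) (U : Subgroup G) (n : ℕ) : Subgroup G where
  carrier := {x | ∀ k ≤ n, α^[k] x ∈ U}
  one_mem' k _ := by rw [iterate_one]; exact U.one_mem
  mul_mem' hx hy k hk := by rw [iterate_mul]; exact U.mul_mem (hx k hk) (hy k hk)
  inv_mem' hx k hk := by rw [iterate_inv]; exact U.inv_mem (hx k hk)

/-- The elements whose forward orbit stays in `U`. -/
def negAll (α : G →ₜ* G) (U : Subgroup G) : Subgroup G where
  carrier := {x | ∀ k, α^[k] x ∈ U}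
  one_mem' k := by rw [iterate_one]; exact U.one_mem
  mul_mem' hx hy k := by rw [iterate_mul]; exact U.mul_mem (hx k) (hy k)
  inv_mem' hx k := by rw [iterate_inv]; exact U.inv_mem (hx k)

/-- The elements whose forward orbit is eventually in `U`. -/
def negEv (α : G →ₜ* G) (U : Subgroup G) : Subgroup G where
  carrier := {x | ∃ m, ∀ k ≥ m, α^[k] x ∈ U}
  one_mem' := ⟨0, fun k _ => by rw [iterate_one]; exact U.one_mem⟩
  mul_mem' := by
    rintro x y ⟨m, hm⟩ ⟨n, hn⟩
    refine ⟨max m n, fun k hk => ?_⟩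
    rw [iterate_mul]
    exact U.mul_mem (hm k (le_of_max_le_left hk)) (hn k (le_of_max_le_right hk))
  inv_mem' := by
    rintro x ⟨m, hm⟩
    exact ⟨m, fun k hk => by rw [iterate_inv]; exact U.inv_mem (hm k hk)⟩

lemma IsRegressive.one (α : G →ₜ* G) : IsRegressive α 1 (fun _ => 1) :=
  ⟨rfl, fun _ => map_one α⟩

lemma IsRegressive.mul {α : G →ₜ* G} {x y : G} {u v : ℕ → G} (hu : IsRegressive α x u)
    (hv : IsRegressive α y v) : IsRegressive α (x * y) (fun n => u n * v n) :=
  ⟨by simp only [hu.zero, hv.zero], fun n => by simp only [map_mul, hu.succ, hv.succ]⟩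

lemma IsRegressive.inv {α : G →ₜ* G} {x : G} {u : ℕ → G} (hu : IsRegressive α x u) :
    IsRegressive α x⁻¹ (fun n => (u n)⁻¹) :=
  ⟨by simp only [hu.zero], fun n => by simp only [map_inv, hu.succ]⟩

lemma IsRegressive.iterate {α : G →ₜ* G} {x : G} {u : ℕ → G} (hu : IsRegressive α x u)
    (m n : ℕ) : α^[n] (u (m + n)) = u m := by
  induction n with
  | zero => rfl
  | succ n ih => rw [Function.iterate_succ_apply, ← Nat.add_assoc, hu.succ, ih]

lemma IsRegressive.iterate_eq {α : G →ₜ* G} {x : G} {u : ℕ → G} (hu : IsRegressive α x u)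
    (n : ℕ) : α^[n] (u n) = x := by
  have h := hu.iterate 0 n
  rwa [Nat.zero_add, hu.zero] at h

lemma IsRegressive.shift {α : G →ₜ* G} {x : G} {u : ℕ → G} (hu : IsRegressive α x u)
    (m : ℕ) : IsRegressive α (u m) (fun n => u (m + n)) :=
  ⟨rfl, fun n => hu.succ (m + n)⟩

/-- Prepending the image of the starting point to a regressive sequence. -/
lemma IsRegressive.cons {α : G →ₜ* G} {x : G} {u : ℕ → G} (hu : IsRegressive α x u) :
    IsRegressive α (α x) (fun n => Nat.casesOn n (α x) u) :=
  ⟨rfl, fun n => by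
    cases n with
    | zero => exact congrArg α hu.zero
    | succ n => exact hu.succ n⟩

/-- The elements having a regressive sequence in `U`. -/
def posAll (α : G →ₜ* G) (U : Subgroup G) : Subgroup G where
  carrier := {x | ∃ u, IsRegressive α x u ∧ ∀ n, u n ∈ U}
  one_mem' := ⟨_, IsRegressive.one α, fun _ => U.one_mem⟩
  mul_mem' := by
    rintro x y ⟨u, hu, huU⟩ ⟨v, hv, hvU⟩
    exact ⟨_, hu.mul hv, fun n => U.mul_mem (huU n) (hvU n)⟩
  inv_mem' := by
    rintro x ⟨u, hu, huU⟩
    exact ⟨_, hu.inv, fun n => U.inv_mem (huU n)⟩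

/-- The elements having a regressive sequence that is eventually in `U`. -/
def posEv (α : G →ₜ* G) (U : Subgroup G) : Subgroup G where
  carrier := {x | ∃ u, IsRegressive α x u ∧ ∃ m, ∀ n ≥ m, u n ∈ U}
  one_mem' := ⟨_, IsRegressive.one α, 0, fun _ _ => U.one_mem⟩
  mul_mem' := by
    rintro x y ⟨u, hu, m, huU⟩ ⟨v, hv, n, hvU⟩
    exact ⟨_, hu.mul hv, max m n, fun k hk =>
      U.mul_mem (huU k (le_of_max_le_left hk)) (hvU k (le_of_max_le_right hk))⟩
  inv_mem' := by
    rintro x ⟨u, hu, m, huU⟩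
    exact ⟨_, hu.inv, m, fun n hn => U.inv_mem (huU n hn)⟩

/-- The elements lying on a two-sided trajectory that is eventually in `U` in both directions. -/
def homoclinic (α : G →ₜ* G) (U : Subgroup G) : Subgroup G := posEv α U ⊓ negEv α U

variable {α : G →ₜ* G} {U V : Subgroup G}

lemma mem_negTrunc {n : ℕ} {x : G} : x ∈ negTrunc α U n ↔ ∀ k ≤ n, α^[k] x ∈ U := Iff.rfl

lemma mem_negAll {x : G} : x ∈ negAll α U ↔ ∀ k, α^[k] x ∈ U := Iff.rfl

lemma negTrunc_zero : negTrunc α U 0 = U := by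
  ext x
  exact ⟨fun h => h 0 le_rfl, fun h k hk => by rwa [Nat.le_zero.mp hk]⟩

lemma negTrunc_antitone : Antitone (negTrunc α U) :=
  fun _ _ hmn _ hx k hk => hx k (hk.trans hmn)

lemma negTrunc_le (n : ℕ) : negTrunc α U n ≤ U := fun _ hx => hx 0 (Nat.zero_le _)

lemma negAll_le_negTrunc (n : ℕ) : negAll α U ≤ negTrunc α U n := fun _ hx k _ => hx k

lemma negAll_le : negAll α U ≤ U := fun _ hx => hx 0

lemma negAll_le_negEv : negAll α U ≤ negEv α U := fun _ hx => ⟨0, fun k _ => hx k⟩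

lemma posAll_le : posAll α U ≤ U := by
  rintro x ⟨u, hu, huU⟩
  exact hu.zero ▸ huU 0

lemma posAll_le_posEv : posAll α U ≤ posEv α U := by
  rintro x ⟨u, hu, huU⟩
  exact ⟨u, hu, 0, fun n _ => huU n⟩

lemma negEv_mono (h : U ≤ V) : negEv α U ≤ negEv α V :=
  fun _ ⟨m, hm⟩ => ⟨m, fun k hk => h (hm k hk)⟩

lemma posEv_mono (h : U ≤ V) : posEv α U ≤ posEv α V :=
  fun _ ⟨u, hu, m, hm⟩ => ⟨u, hu, m, fun k hk => h (hm k hk)⟩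

lemma homoclinic_mono (h : U ≤ V) : homoclinic α U ≤ homoclinic α V :=
  inf_le_inf (posEv_mono h) (negEv_mono h)

lemma iterate_mem_negAll {x : G} (hx : x ∈ negAll α U) (n : ℕ) : α^[n] x ∈ negAll α U :=
  fun k => by rw [← Function.iterate_add_apply]; exact hx _

lemma iterate_mem_negEv_iff {x : G} (n : ℕ) : α^[n] x ∈ negEv α U ↔ x ∈ negEv α U := by
  constructor
  · rintro ⟨m, hm⟩
    refine ⟨m + n, fun k hk => ?_⟩
    have := hm (k - n) (by omega)
    rwa [← Function.iterate_add_apply, Nat.sub_add_cancel (by omega)] at this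
  · rintro ⟨m, hm⟩
    refine ⟨m, fun k hk => ?_⟩
    rw [← Function.iterate_add_apply]
    exact hm _ (by omega)

lemma map_mem_negEv_iff {x : G} : α x ∈ negEv α U ↔ x ∈ negEv α U :=
  iterate_mem_negEv_iff 1

lemma map_mem_posEv {x : G} (hx : x ∈ posEv α U) : α x ∈ posEv α U := by
  obtain ⟨u, hu, m, hm⟩ := hx
  refine ⟨_, hu.cons, m + 1, fun n hn => ?_⟩
  obtain ⟨n, rfl⟩ : ∃ k, n = k + 1 := ⟨n - 1, by omega⟩
  exact hm n (by omega)

lemma exists_posEv_map_eq {x : G} (hx : x ∈ posEv α U) : ∃ y ∈ posEv α U, α y = x := by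
  obtain ⟨u, hu, m, hm⟩ := hx
  refine ⟨u 1, ⟨_, hu.shift 1, m, fun n hn => hm _ (by omega)⟩, ?_⟩
  rw [← hu.zero]
  exact hu.succ 0

lemma exists_posAll_iterate_eq {x : G} (hx : x ∈ posAll α U) (n : ℕ) :
    ∃ y ∈ posAll α U, y ∈ negTrunc α U n ∧ α^[n] y = x := by
  obtain ⟨u, hu, huU⟩ := hx
  refine ⟨u n, ⟨_, hu.shift n, fun k => huU _⟩, fun k hk => ?_, hu.iterate_eq n⟩
  have := hu.iterate (n - k) k
  rw [Nat.sub_add_cancel hk] at this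
  rw [this]
  exact huU _

lemma map_mem_posAll {x : G} (hx : x ∈ posAll α U) (h : α x ∈ U) : α x ∈ posAll α U := by
  obtain ⟨u, hu, huU⟩ := hx
  refine ⟨_, hu.cons, fun n => ?_⟩
  cases n with
  | zero => exact h
  | succ n => exact huU n

lemma map_homoclinic : (homoclinic α U).map α.toMonoidHom = homoclinic α U := by
  apply le_antisymm
  · rintro _ ⟨x, hx, rfl⟩
    exact ⟨map_mem_posEv hx.1, map_mem_negEv_iff.mpr hx.2⟩
  · intro x hx
    obtain ⟨y, hy, rfl⟩ := exists_posEv_map_eq hx.1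
    exact ⟨y, ⟨hy, map_mem_negEv_iff.mp hx.2⟩, rfl⟩

lemma negTrunc_add (m n : ℕ) :
    negTrunc α U (m + n) = negTrunc α U m ⊓ (negTrunc α U n).comap (iterHom α m) := by
  ext x
  constructor
  · refine fun h => ⟨fun k hk => h k (by omega), fun k hk => ?_⟩
    rw [iterHom_apply, ← Function.iterate_add_apply]
    exact h _ (by omega)
  · rintro ⟨h₁, h₂⟩ k hk
    rcases le_total k m with h | h
    · exact h₁ k h
    · have := h₂ (k - m) (by omega)
      rwa [iterHom_apply, ← Function.iterate_add_apply, Nat.sub_add_cancel h] at this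

lemma negTrunc_negTrunc (m n : ℕ) :
    negTrunc α (negTrunc α U m) n = negTrunc α U (m + n) := by
  ext x
  constructor
  · intro h k hk
    have := h (k - m) (by omega) (min k m) (min_le_right _ _)
    rwa [← Function.iterate_add_apply, show min k m + (k - m) = k by omega] at this
  · intro h k hk j hj
    rw [← Function.iterate_add_apply]
    exact h _ (by omega)

lemma le_negTrunc_of_map_le {L : Subgroup G} (hL : L.map α.toMonoidHom ≤ L) (h : L ≤ U) (n : ℕ) :
    L ≤ negTrunc α U n := by
  have hk : ∀ k, ∀ x ∈ L, α^[k] x ∈ L := by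
    intro k
    induction k with
    | zero => exact fun x hx => hx
    | succ k ih => exact fun x hx => ih _ (hL ⟨x, hx, rfl⟩)
  exact fun x hx k _ => h (hk k x hx)

lemma isOpen_negTrunc (ho : IsOpen (U : Set G)) (n : ℕ) : IsOpen (negTrunc α U n : Set G) := by
  have : (negTrunc α U n : Set G) = ⋂ k ∈ Finset.range (n + 1), α^[k] ⁻¹' U := by
    ext x
    simp [mem_negTrunc]
  rw [this]
  exact isOpen_biInter_finset fun k _ => ho.preimage (continuous_iterate α k)

lemma isClosed_negAll (hc : IsClosed (U : Set G)) : IsClosed (negAll α U : Set G) := by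
  have : (negAll α U : Set G) = ⋂ k, α^[k] ⁻¹' U := by
    ext x
    simp [mem_negAll]
  rw [this]
  exact isClosed_iInter fun k => hc.preimage (continuous_iterate α k)

end Subgroups

/-! ### Coset counting -/

section Index

variable {G : Type*} [Group G]

/-- The cosets of `H` in `K₁` embed into those in `K₂`; equal finite cardinality makes the embedding
onto. -/
lemma exists_inv_mul_mem_of_relIndex_eq {H K₁ K₂ : Subgroup G} (hle : K₁ ≤ K₂)
    (heq : H.relIndex K₁ = H.relIndex K₂) (h0 : H.relIndex K₂ ≠ 0) {y : G} (hy : y ∈ K₂) :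
    ∃ x ∈ K₁, x⁻¹ * y ∈ H := by
  have hf : Finite (K₂ ⧸ H.subgroupOf K₂) := Nat.finite_of_card_ne_zero h0
  let e := Subgroup.quotientSubgroupOfEmbeddingOfLE H hle
  have hs : Function.Surjective e :=
    (Function.Injective.bijective_of_nat_card_le e.injective (le_of_eq heq.symm)).2
  obtain ⟨q, hq⟩ := hs (QuotientGroup.mk ⟨y, hy⟩)
  obtain ⟨x, rfl⟩ := QuotientGroup.mk_surjective q
  refine ⟨x, x.2, ?_⟩
  rw [Subgroup.quotientSubgroupOfEmbeddingOfLE_apply_mk, QuotientGroup.eq] at hq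
  exact hq

lemma le_relIndex_of_pairwise {H K : Subgroup G} {n : ℕ} (x : Fin n → G) (hx : ∀ i, x i ∈ K)
    (hxH : ∀ i j, i < j → (x i)⁻¹ * x j ∉ H) (h0 : H.relIndex K ≠ 0) : n ≤ H.relIndex K := by
  have hf : Finite (K ⧸ H.subgroupOf K) := Nat.finite_of_card_ne_zero h0
  let f : Fin n → K ⧸ H.subgroupOf K := fun i => QuotientGroup.mk ⟨x i, hx i⟩
  have hne : ∀ i j, i < j → f i ≠ f j := by
    intro i j hij h
    exact hxH i j hij ((QuotientGroup.eq (s := H.subgroupOf K) (a := ⟨x i, hx i⟩)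
      (b := ⟨x j, hx j⟩)).mp h)
  have hinj : Function.Injective f := by
    intro i j h
    rcases lt_trichotomy i j with hij | hij | hij
    · exact (hne i j hij h).elim
    · exact hij
    · exact (hne j i hij h.symm).elim
  have := Nat.card_le_card_of_injective f hinj
  rwa [Nat.card_fin] at this

variable [TopologicalSpace G] [IsTopologicalGroup G]

lemma relIndex_ne_zero_of_isOpen_of_isCompact {H K : Subgroup G} (hH : IsOpen (H : Set G))
    (hK : IsCompact (K : Set G)) : H.relIndex K ≠ 0 := by
  have : CompactSpace K := isCompact_iff_compactSpace.mp hK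
  have ho : IsOpen (H.subgroupOf K : Set K) := hH.preimage continuous_subtype_val
  have := Subgroup.quotient_finite_of_isOpen (H.subgroupOf K) ho
  exact Subgroup.finiteIndex_iff.mp (Subgroup.finiteIndex_of_finite_quotient)

end Index

/-! ### Compact open subgroups -/

section CompactOpen

variable {G : Type*} [Group G]

lemma stabilizer_subset_of_one_mem {S : Set G} (h1 : (1 : G) ∈ S) :
    (MulAction.stabilizer G S : Set G) ⊆ S := by
  intro g hg
  have h : g • S = S := hg
  rw [← h]
  exact ⟨1, h1, by simp⟩

variable [TopologicalSpace G] [IsTopologicalGroup G]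

lemma isOpen_stabilizer_of_isCompact_of_isOpen {S : Set G} (hc : IsCompact S) (ho : IsOpen S) :
    IsOpen (MulAction.stabilizer G S : Set G) := by
  obtain ⟨V, hV, hVS⟩ := compact_open_separated_mul_left hc ho le_rfl
  have hsub : ∀ g ∈ V, g • S ⊆ S := by
    rintro g hg _ ⟨s, hs, rfl⟩
    exact hVS (Set.mul_mem_mul hg hs)
  refine Subgroup.isOpen_of_mem_nhds _ (g := 1) (Filter.mem_of_superset
    (Filter.inter_mem hV (inv_mem_nhds_one G hV)) ?_)
  rintro g ⟨hg, hg'⟩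
  refine Set.Subset.antisymm (hsub g hg) ?_
  rw [Set.subset_smul_set_iff]
  exact hsub g⁻¹ hg'

/-- The product set `L * U` is compact and open but need not be a group; its stabilizer under left
translation is one, and contains `L`. -/
lemma exists_isCompact_isOpen_subgroup_between {L U : Subgroup G} (hL : IsCompact (L : Set G))
    (hU : IsCompact (U : Set G)) (hUo : IsOpen (U : Set G)) :
    ∃ O : Subgroup G, IsCompact (O : Set G) ∧ IsOpen (O : Set G) ∧ L ≤ O ∧
      (O : Set G) ⊆ (L : Set G) * (U : Set G) := by
  have hSo : IsOpen ((L : Set G) * (U : Set G)) := hUo.mul_left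
  have hSc : IsCompact ((L : Set G) * (U : Set G)) := hL.mul hU
  have ho := isOpen_stabilizer_of_isCompact_of_isOpen hSc hSo
  have hsub := stabilizer_subset_of_one_mem (S := (L : Set G) * (U : Set G))
    ⟨1, L.one_mem, 1, U.one_mem, one_mul 1⟩
  refine ⟨_, hSc.of_isClosed_subset (Subgroup.isClosed_of_isOpen _ ho) hsub, ho, ?_, hsub⟩
  intro l hl
  change l • ((L : Set G) * (U : Set G)) = (L : Set G) * (U : Set G)
  rw [← smul_mul_assoc, smul_coe_set hl]

variable [T2Space G] [LocallyCompactSpace G] [TotallyDisconnectedSpace G]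

/-- Van Dantzig's theorem. -/
lemma exists_isCompact_isOpen_subgroup_subset {N : Set G} (hN : N ∈ 𝓝 (1 : G)) :
    ∃ U : Subgroup G, IsCompact (U : Set G) ∧ IsOpen (U : Set G) ∧ (U : Set G) ⊆ N := by
  obtain ⟨C, hC, hCN, hCc⟩ := local_compact_nhds hN
  obtain ⟨S, hS, h1S, hSC⟩ := (loc_compact_Haus_tot_disc_of_zero_dim (H := G)).mem_nhds_iff.mp hC
  have hSc : IsCompact S := hCc.of_isClosed_subset hS.1 hSC
  have ho := isOpen_stabilizer_of_isCompact_of_isOpen hSc hS.2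
  have hsub := stabilizer_subset_of_one_mem h1S
  exact ⟨_, hSc.of_isClosed_subset (Subgroup.isClosed_of_isOpen _ ho) hsub, ho,
    hsub.trans (hSC.trans hCN)⟩

lemma mem_of_forall_mem_isCompact_isOpen {L : Subgroup G} (hL : IsCompact (L : Set G)) {x : G}
    (h : ∀ O : Subgroup G, IsCompact (O : Set G) → IsOpen (O : Set G) → L ≤ O → x ∈ O) :
    x ∈ L := by
  have hcl : IsClosed (L : Set G) := hL.isClosed
  change x ∈ (L : Set G)
  rw [← hcl.closure_eq, mem_closure_iff_nhds]
  intro t ht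
  have hN : (x * ·) ⁻¹' t ∈ 𝓝 (1 : G) :=
    (continuous_const_mul x).continuousAt.preimage_mem_nhds (by simpa using ht)
  obtain ⟨U, hUc, hUo, hUN⟩ := exists_isCompact_isOpen_subgroup_subset hN
  obtain ⟨O, hOc, hOo, hLO, hOL⟩ := exists_isCompact_isOpen_subgroup_between hL hUc hUo
  obtain ⟨l, hl, v, hv, hlv⟩ := hOL (h O hOc hOo hLO)
  refine ⟨l, ?_, hl⟩
  have : x * v⁻¹ ∈ t := hUN (U.inv_mem hv)
  rwa [← hlv, mul_inv_cancel_right] at this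

end CompactOpen

/-! ### Compactness arguments for regressive sequences -/

section Sequences

variable {G : Type*} [Group G] [TopologicalSpace G] [T2Space G] {α : G →ₜ* G} {U : Subgroup G}

/-- Finite orbit segments in `U`, read backwards from their endpoints, approximate a regressive
sequence; compactness of the product of copies of `U` supplies a limit. -/
lemma exists_isRegressive_of_forall_exists (hU : IsCompact (U : Set G)) {C : ℕ → Set G}
    (hC : ∀ n, IsClosed (C n)) (hanti : Antitone C)
    (h : ∀ n, ∃ x ∈ negTrunc α U n, α^[n] x ∈ C n) :
    ∃ u, IsRegressive α (u 0) u ∧ (∀ n, u n ∈ U) ∧ ∀ n, u 0 ∈ C n := by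
  let S : ℕ → Set (ℕ → G) := fun n =>
    (Set.univ.pi fun _ => (U : Set G)) ∩ ({u | ∀ k < n, α (u (k + 1)) = u k} ∩ {u | u 0 ∈ C n})
  have hpi : IsCompact (Set.univ.pi fun _ : ℕ => (U : Set G)) := isCompact_univ_pi fun _ => hU
  have hcl : ∀ n, IsClosed ({u : ℕ → G | ∀ k < n, α (u (k + 1)) = u k} ∩ {u | u 0 ∈ C n}) := by
    intro n
    refine IsClosed.inter ?_ ((hC n).preimage (continuous_apply 0))
    simp only [Set.ofPred_forall]
    exact isClosed_iInter fun k => isClosed_iInter fun _ => isClosed_eq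
      ((map_continuous α).comp (continuous_apply (k + 1))) (continuous_apply k)
  have hSc : ∀ n, IsCompact (S n) := fun n => hpi.inter_right (hcl n)
  obtain ⟨u, hu⟩ := IsCompact.nonempty_iInter_of_sequence_nonempty_isCompact_isClosed S
    (fun n u hu => ⟨hu.1, fun k hk => hu.2.1 k (by omega), hanti (Nat.le_succ n) hu.2.2⟩)
    (fun n => by
      obtain ⟨x, hx, hxC⟩ := h n
      refine ⟨fun k => α^[n - k] x, fun k _ => hx _ (Nat.sub_le n k), fun k hk => ?_, hxC⟩
      change α (α^[n - (k + 1)] x) = α^[n - k] x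
      rw [← Function.iterate_succ_apply' α, show (n - (k + 1)).succ = n - k by omega])
    (hSc 0) (fun n => (hSc n).isClosed)
  rw [Set.mem_iInter] at hu
  exact ⟨u, ⟨rfl, fun n => (hu (n + 1)).2.1 n (Nat.lt_succ_self n)⟩,
    fun n => (hu 0).1 n (Set.mem_univ n), fun n => (hu n).2.2⟩

lemma isCompact_posAll (hU : IsCompact (U : Set G)) : IsCompact (posAll α U : Set G) := by
  have hpi : IsCompact (Set.univ.pi fun _ : ℕ => (U : Set G)) := isCompact_univ_pi fun _ => hU
  have hcl : IsClosed {u : ℕ → G | ∀ k, α (u (k + 1)) = u k} := by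
    simp only [Set.ofPred_forall]
    exact isClosed_iInter fun k => isClosed_eq
      ((map_continuous α).comp (continuous_apply (k + 1))) (continuous_apply k)
  have := (hpi.inter_right hcl).image (continuous_apply (0 : ℕ))
  convert this using 1
  ext x
  constructor
  · rintro ⟨u, hu, huU⟩
    exact ⟨u, ⟨fun n _ => huU n, hu.succ⟩, hu.zero⟩
  · rintro ⟨u, ⟨huU, hu⟩, rfl⟩
    exact ⟨u, ⟨rfl, hu⟩, fun n => huU n (Set.mem_univ n)⟩

end Sequences

/-! ### Subgroups that are tidy above -/

section TidyAbove

variable {G : Type*} [Group G] [TopologicalSpace G] {α : G →ₜ* G} {U : Subgroup G}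

lemma relIndex_negTrunc_add (m n : ℕ) :
    (negTrunc α U (m + n)).relIndex (negTrunc α U m) =
      (negTrunc α U n).relIndex ((negTrunc α U m).map (iterHom α m)) := by
  rw [negTrunc_add, inf_comm, Subgroup.inf_relIndex_right, Subgroup.relIndex_comap]

lemma displacementIndex_eq_relIndex (α : G →ₜ* G) (U : Subgroup G) :
    displacementIndex α U = (negTrunc α U 1).relIndex U := by
  rw [displacementIndex, inf_comm, Subgroup.inf_relIndex_right]
  have h1 : negTrunc α U 1 = U.comap α.toMonoidHom ⊓ U := by
    ext x
    constructor
    · exact fun h => ⟨h 1 le_rfl, h 0 (Nat.zero_le 1)⟩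
    · rintro ⟨h₁, h₂⟩ k hk
      interval_cases k
      exacts [h₂, h₁]
  rw [h1, Subgroup.inf_relIndex_right, Subgroup.relIndex_comap]

lemma displacementIndex_negTrunc (α : G →ₜ* G) (U : Subgroup G) (n : ℕ) :
    displacementIndex α (negTrunc α U n) =
      (negTrunc α U (n + 1)).relIndex (negTrunc α U n) := by
  rw [displacementIndex_eq_relIndex, negTrunc_negTrunc]

/-- The displacement index does not change when `U` is replaced by `negTrunc α U n`. -/
def IsTidyAbove (α : G →ₜ* G) (U : Subgroup G) : Prop :=
  ∀ n, displacementIndex α (negTrunc α U n) = displacementIndex α U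

lemma IsTidyAbove.relIndex_add (h : IsTidyAbove α U) (m n : ℕ) :
    (negTrunc α U (m + n)).relIndex (negTrunc α U m) = displacementIndex α U ^ n := by
  induction n with
  | zero => rw [pow_zero, Nat.add_zero, Subgroup.relIndex_self]
  | succ n ih =>
    rw [← Subgroup.relIndex_mul_relIndex (negTrunc α U (m + (n + 1))) (negTrunc α U (m + n))
      (negTrunc α U m) (negTrunc_antitone (by omega)) (negTrunc_antitone (by omega)), ih,
      ← Nat.add_assoc, ← displacementIndex_negTrunc, h, pow_succ, mul_comm]

lemma IsTidyAbove.relIndex (h : IsTidyAbove α U) (n : ℕ) :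
    (negTrunc α U n).relIndex U = displacementIndex α U ^ n := by
  have := h.relIndex_add 0 n
  rwa [negTrunc_zero, Nat.zero_add] at this

lemma map_iterHom_negTrunc_antitone :
    Antitone fun n => (negTrunc α U n).map (iterHom α n) := by
  refine antitone_nat_of_succ_le fun n => ?_
  rintro _ ⟨x, hx, rfl⟩
  refine ⟨α x, fun k hk => ?_, rfl⟩
  rw [← Function.iterate_succ_apply]
  exact hx _ (by omega)

lemma map_iterHom_negTrunc_le (n : ℕ) : (negTrunc α U n).map (iterHom α n) ≤ U := by
  rintro _ ⟨x, hx, rfl⟩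
  exact hx n le_rfl

variable [IsTopologicalGroup G]

lemma isCompact_negTrunc (hc : IsCompact (U : Set G)) (ho : IsOpen (U : Set G)) (n : ℕ) :
    IsCompact (negTrunc α U n : Set G) :=
  hc.of_isClosed_subset (Subgroup.isClosed_of_isOpen _ (isOpen_negTrunc ho n)) (negTrunc_le n)

/-- The `n`th index counts cosets of `negTrunc α U 1` in the image of `negTrunc α U n` under
`α^[n]`, and these images shrink with `n`. -/
lemma displacementIndex_negTrunc_antitone (hc : IsCompact (U : Set G)) (ho : IsOpen (U : Set G)) :
    Antitone fun n => displacementIndex α (negTrunc α U n) := by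
  intro m n hmn
  simp only [displacementIndex_negTrunc, relIndex_negTrunc_add]
  refine Subgroup.relIndex_le_of_le_right (map_iterHom_negTrunc_antitone hmn) fun h0 => ?_
  exact relIndex_ne_zero_of_isOpen_of_isCompact (isOpen_negTrunc ho 1) hc
    (Subgroup.relIndex_eq_zero_of_le_right (map_iterHom_negTrunc_le m) h0)

lemma displacementIndex_negTrunc_le (hc : IsCompact (U : Set G)) (ho : IsOpen (U : Set G))
    (n : ℕ) : displacementIndex α (negTrunc α U n) ≤ displacementIndex α U := by
  have := displacementIndex_negTrunc_antitone (α := α) hc ho (Nat.zero_le n)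
  simpa only [negTrunc_zero] using this

lemma exists_isTidyAbove_negTrunc (hc : IsCompact (U : Set G)) (ho : IsOpen (U : Set G)) :
    ∃ n, IsTidyAbove α (negTrunc α U n) := by
  obtain ⟨n, hn⟩ := WellFoundedLT.antitone_chain_condition
    (displacementIndex_negTrunc_antitone (α := α) hc ho)
  refine ⟨n, fun m => ?_⟩
  rw [negTrunc_negTrunc]
  exact (hn (n + m) (by omega)).symm

lemma relIndex_negTrunc_le_pow (hc : IsCompact (U : Set G)) (ho : IsOpen (U : Set G)) (n : ℕ) :
    (negTrunc α U n).relIndex U ≤ displacementIndex α U ^ n := by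
  induction n with
  | zero => rw [negTrunc_zero, pow_zero, Subgroup.relIndex_self]
  | succ n ih =>
    rw [← Subgroup.relIndex_mul_relIndex (negTrunc α U (n + 1)) (negTrunc α U n) U
      (negTrunc_antitone (by omega)) (negTrunc_le n), pow_succ', ← displacementIndex_negTrunc]
    exact Nat.mul_le_mul (displacementIndex_negTrunc_le hc ho n) ih

/-- Tidiness above makes two indices of `negTrunc α U n` agree, in `U` and in the image of `negTrunc
α U n` under `α^[n]`. So this image meets every coset in `U`, and a limit over `n` yields the factor
`z`. -/
lemma IsTidyAbove.exists_mul [T2Space G] (h : IsTidyAbove α U) (hc : IsCompact (U : Set G))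
    (ho : IsOpen (U : Set G)) {y : G} (hy : y ∈ U) :
    ∃ z ∈ posAll α U, z⁻¹ * y ∈ negAll α U := by
  have hcl : ∀ n, IsClosed {z : G | z⁻¹ * y ∈ negTrunc α U n} := fun n =>
    (Subgroup.isClosed_of_isOpen _ (isOpen_negTrunc ho n)).preimage (by fun_prop)
  obtain ⟨u, hu, huU, huy⟩ := exists_isRegressive_of_forall_exists (α := α) hc hcl
    (fun m n hmn z hz => negTrunc_antitone hmn hz) (fun n => by
      have heq : (negTrunc α U n).relIndex ((negTrunc α U n).map (iterHom α n)) =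
          (negTrunc α U n).relIndex U := by
        rw [← relIndex_negTrunc_add, h.relIndex_add, h.relIndex]
      obtain ⟨_, ⟨x, hx, rfl⟩, hxy⟩ := exists_inv_mul_mem_of_relIndex_eq
        (map_iterHom_negTrunc_le n) heq
        (relIndex_ne_zero_of_isOpen_of_isCompact (isOpen_negTrunc ho n) hc) hy
      exact ⟨x, hx, hxy⟩)
  exact ⟨u 0, ⟨u, hu, huU⟩, fun n => huy n n le_rfl⟩

end TidyAbove

/-! ### Relative compactness of the homoclinic subgroup -/

section Homoclinic

variable {G : Type*} [Group G] [TopologicalSpace G]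
  {α : G →ₜ* G} {U V : Subgroup G}

lemma exists_homoclinic_iterate {x : G} (hx : x ∈ homoclinic α U) :
    ∃ n, ∃ w ∈ posAll α U ⊓ negEv α U, α^[n] w = x := by
  obtain ⟨⟨u, hu, m, hm⟩, hx'⟩ := hx
  refine ⟨m, u m, ⟨⟨_, hu.shift m, fun n => hm _ (by omega)⟩, ?_⟩, hu.iterate_eq m⟩
  refine (iterate_mem_negEv_iff m).mp ?_
  rw [hu.iterate_eq m]
  exact hx'

variable [IsTopologicalGroup G]

/-- Homoclinic elements are iterates of elements of `W`. Applying `α` to `W` produces only finitely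
many new cosets of `W`, with representatives whose orbits end in `U`, so one time `N` serves them
all. -/
lemma exists_homoclinic_subset (hc : IsCompact (U : Set G)) (ho : IsOpen (U : Set G)) :
    ∃ N, (homoclinic α U : Set G) ⊆ (U : Set G) * α^[N] '' (U : Set G) := by
  let W := posAll α U ⊓ negEv α U
  have hWα : ∀ w ∈ W, ∃ w' ∈ W, α w' = w := by
    rintro w ⟨hw, hw'⟩
    obtain ⟨y, hy, -, rfl⟩ := exists_posAll_iterate_eq hw 1
    exact ⟨y, ⟨hy, map_mem_negEv_iff.mp hw'⟩, rfl⟩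
  -- finitely many cosets of `W` cover its image
  obtain ⟨F, hF, hFW⟩ : ∃ F : Set G, F.Finite ∧ (∀ f ∈ F, f ∈ negEv α U) ∧
      ∀ w ∈ W, ∃ f ∈ F, f⁻¹ * α w ∈ W := by
    let M := W.map α.toMonoidHom
    have hcomp : IsCompact (U.map α.toMonoidHom : Set G) := hc.image (map_continuous α)
    have hfin : Finite (M ⧸ U.subgroupOf M) := Nat.finite_of_card_ne_zero fun h0 =>
      relIndex_ne_zero_of_isOpen_of_isCompact ho hcomp (Subgroup.relIndex_eq_zero_of_le_right
        (Subgroup.map_mono (inf_le_left.trans posAll_le)) h0)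
    refine ⟨Set.range fun q : M ⧸ U.subgroupOf M => (q.out : G), Set.finite_range _, ?_, ?_⟩
    · rintro _ ⟨q, rfl⟩
      obtain ⟨w, hw, hwq⟩ := q.out.2
      change (q.out : G) ∈ negEv α U
      rw [← hwq]
      exact map_mem_negEv_iff.mpr hw.2
    · intro w hw
      let q : M ⧸ U.subgroupOf M := QuotientGroup.mk ⟨α w, w, hw, rfl⟩
      refine ⟨_, ⟨q, rfl⟩, ?_⟩
      obtain ⟨v, hv, hvq⟩ := q.out.2
      have hU : (q.out : G)⁻¹ * α w ∈ U :=
        (QuotientGroup.eq (s := U.subgroupOf M)).mp (QuotientGroup.out_eq' q)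
      have heq : (q.out : G)⁻¹ * α w = α (v⁻¹ * w) := by
        rw [← hvq, map_mul, map_inv]
        rfl
      have hvw := W.mul_mem (W.inv_mem hv) hw
      change (q.out : G)⁻¹ * α w ∈ W
      rw [heq] at hU ⊢
      exact ⟨map_mem_posAll hvw.1 hU, map_mem_negEv_iff.mpr hvw.2⟩
  obtain ⟨hFev, hFW⟩ := hFW
  -- a common time after which the orbits of these representatives stay in `U`
  obtain ⟨N, hN⟩ : ∃ N, ∀ f ∈ F, ∀ k ≥ N, α^[k] f ∈ U := by
    choose! m hm using hFev
    obtain ⟨N, hN⟩ := (hF.image m).bddAbove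
    exact ⟨N, fun f hf k hk => hm f hf k ((hN ⟨f, hf, rfl⟩).trans hk)⟩
  have hlow : ∀ n ≤ N, ∀ w ∈ W, ∃ w' ∈ W, α^[N] w' = α^[n] w := by
    intro n hn
    have hWn : ∀ k, ∀ w ∈ W, ∃ w' ∈ W, α^[k] w' = w := by
      intro k
      induction k with
      | zero => exact fun w hw => ⟨w, hw, rfl⟩
      | succ k ih =>
        intro w hw
        obtain ⟨w₁, hw₁, rfl⟩ := ih w hw
        obtain ⟨w₂, hw₂, rfl⟩ := hWα w₁ hw₁
        exact ⟨w₂, hw₂, rfl⟩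
    intro w hw
    obtain ⟨w', hw', rfl⟩ := hWn (N - n) w hw
    refine ⟨w', hw', ?_⟩
    rw [← Function.iterate_add_apply, Nat.add_sub_cancel' hn]
  -- Each further step splits off a factor `α^[N + n] f`, whose whole forward orbit lies in `U` by
  -- the choice of `N`.
  have hhigh : ∀ n, ∀ w ∈ W, ∃ v ∈ negAll α U, ∃ w' ∈ W, v * α^[N] w' = α^[N + n] w := by
    intro n
    induction n with
    | zero => exact fun w hw => ⟨1, one_mem _, w, hw, one_mul _⟩
    | succ n ih =>
      intro w hw
      obtain ⟨f, hf, hfw⟩ := hFW w hw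
      obtain ⟨v, hv, w', hw', hvw⟩ := ih _ hfw
      refine ⟨α^[N + n] f * v, mul_mem (fun k => ?_) hv, w', hw', ?_⟩
      · rw [← Function.iterate_add_apply]
        exact hN f hf _ (by omega)
      · rw [mul_assoc, hvw, ← iterate_mul, mul_inv_cancel_left, ← Nat.add_assoc,
          Function.iterate_succ_apply]
  refine ⟨N, fun x hx => ?_⟩
  obtain ⟨n, w, hw, rfl⟩ := exists_homoclinic_iterate hx
  rcases le_total n N with h | h
  · obtain ⟨w', hw', hww'⟩ := hlow n h w hw
    exact ⟨1, U.one_mem, _, ⟨w', posAll_le hw'.1, hww'⟩, one_mul _⟩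
  · obtain ⟨v, hv, w', hw', hvw⟩ := hhigh (n - N) w hw
    rw [Nat.add_sub_cancel' h] at hvw
    exact ⟨v, negAll_le hv, _, ⟨w', posAll_le hw'.1, rfl⟩, hvw⟩

lemma isCompact_homoclinic_topologicalClosure [T2Space G] (hc : IsCompact (U : Set G))
    (ho : IsOpen (U : Set G)) : IsCompact ((homoclinic α U).topologicalClosure : Set G) := by
  obtain ⟨N, hN⟩ := exists_homoclinic_subset (α := α) hc ho
  exact (hc.mul (hc.image (continuous_iterate α N))).closure_of_subset hN

lemma map_topologicalClosure_eq [T2Space G] {H : Subgroup G} (hH : H.map α.toMonoidHom = H)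
    (hc : IsCompact (H.topologicalClosure : Set G)) :
    H.topologicalClosure.map α.toMonoidHom = H.topologicalClosure := by
  apply le_antisymm
  · rw [Subgroup.map_le_iff_le_comap]
    refine H.topologicalClosure_minimal ?_
      (H.isClosed_topologicalClosure.preimage (map_continuous α))
    rw [← Subgroup.map_le_iff_le_comap, hH]
    exact H.le_topologicalClosure
  · refine H.topologicalClosure_minimal ?_ (hc.image (map_continuous α)).isClosed
    conv_lhs => rw [← hH]
    exact Subgroup.map_mono H.le_topologicalClosure

lemma map_homoclinic_topologicalClosure [T2Space G] (hc : IsCompact (U : Set G))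
    (ho : IsOpen (U : Set G)) : (homoclinic α U).topologicalClosure.map α.toMonoidHom =
      (homoclinic α U).topologicalClosure :=
  map_topologicalClosure_eq map_homoclinic (isCompact_homoclinic_topologicalClosure hc ho)

end Homoclinic

/-! ### Tidy subgroups and the scale -/

section Scale

variable {G : Type*} [Group G] [TopologicalSpace G]
  {α : G →ₜ* G} {U V W : Subgroup G}

/-- A subgroup is tidy if it is tidy above and each of its elements whose orbit is eventually
in it has its whole orbit in it. -/
structure IsTidy (α : G →ₜ* G) (U : Subgroup G) : Prop where
  isCompact : IsCompact (U : Set G)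
  isOpen : IsOpen (U : Set G)
  isTidyAbove : IsTidyAbove α U
  inf_negEv_le : U ⊓ negEv α U ≤ negAll α U

lemma scale_le (hc : IsCompact (U : Set G)) (ho : IsOpen (U : Set G)) :
    scale α ≤ displacementIndex α U :=
  Nat.sInf_le ⟨U, hc, ho, rfl⟩

lemma negTrunc_le_comap_inf (n : ℕ) : negTrunc α U n ≤ U.comap (iterHom α n) ⊓ U :=
  fun _ hx => ⟨hx n le_rfl, hx 0 (Nat.zero_le n)⟩

lemma isMinimizing_of_le (hc : IsCompact (U : Set G)) (ho : IsOpen (U : Set G))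
    (h : ∀ V : Subgroup G, IsCompact (V : Set G) → IsOpen (V : Set G) →
      displacementIndex α U ≤ displacementIndex α V) : IsMinimizing α U := by
  refine ⟨hc, ho, le_antisymm ?_ (scale_le hc ho)⟩
  obtain ⟨V, hVc, hVo, hV⟩ := Nat.sInf_mem (s := {n | ∃ U : Subgroup G,
    IsCompact (U : Set G) ∧ IsOpen (U : Set G) ∧ n = displacementIndex α U}) ⟨_, U, hc, ho, rfl⟩
  exact (h V hVc hVo).trans hV.ge

variable [IsTopologicalGroup G]

lemma IsMinimizing.isMinimizing_negTrunc (h : IsMinimizing α U) (n : ℕ) :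
    IsMinimizing α (negTrunc α U n) := by
  have hc := isCompact_negTrunc (α := α) h.isCompact h.isOpen n
  have ho := isOpen_negTrunc (α := α) h.isOpen n
  refine ⟨hc, ho, le_antisymm ?_ (scale_le hc ho)⟩
  rw [← h.index_eq]
  exact displacementIndex_negTrunc_le h.isCompact h.isOpen n

lemma IsMinimizing.isTidyAbove (h : IsMinimizing α U) : IsTidyAbove α U := fun n => by
  rw [h.index_eq, (h.isMinimizing_negTrunc n).index_eq]

/-- The factor `U.relIndex W * W.relIndex U` is independent of `n`, so growth rates can be compared
between compact open subgroups. -/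
lemma relIndex_comap_iterate_le (hU : IsCompact (U : Set G)) (hUo : IsOpen (U : Set G))
    (hW : IsCompact (W : Set G)) (hWo : IsOpen (W : Set G)) (n : ℕ) :
    (W.comap (iterHom α n)).relIndex W ≤
      U.relIndex W * W.relIndex U * (U.comap (iterHom α n)).relIndex U := by
  set f := iterHom α n
  have hf : ∀ {V : Subgroup G}, IsOpen (V : Set G) → IsOpen (V.comap f : Set G) := fun hV =>
    hV.preimage (continuous_iterate α n)
  have hne : ∀ {H K : Subgroup G}, IsOpen (H : Set G) → IsCompact (K : Set G) →
    H.relIndex K ≠ 0 := relIndex_ne_zero_of_isOpen_of_isCompact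
  calc (W.comap f).relIndex W
      ≤ (W.comap f ⊓ U).relIndex W :=
        Subgroup.relIndex_le_of_le_left inf_le_left (hne ((hf hWo).inter hUo) hW)
    _ = (W.comap f).relIndex (U ⊓ W) * U.relIndex W := by
        rw [Subgroup.relIndex_inf_mul_relIndex]
    _ ≤ (W.comap f).relIndex U * U.relIndex W := Nat.mul_le_mul_right _
        (Subgroup.relIndex_le_of_le_right inf_le_left (hne (hf hWo) hU))
    _ ≤ (W.comap f ⊓ U.comap f).relIndex U * U.relIndex W := Nat.mul_le_mul_right _
        (Subgroup.relIndex_le_of_le_left inf_le_left (hne ((hf hWo).inter (hf hUo)) hU))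
    _ = (W.comap f).relIndex (U.comap f ⊓ U) * (U.comap f).relIndex U * U.relIndex W := by
        rw [Subgroup.relIndex_inf_mul_relIndex]
    _ ≤ W.relIndex U * (U.comap f).relIndex U * U.relIndex W := by
        refine Nat.mul_le_mul_right _ (Nat.mul_le_mul_right _ ?_)
        rw [Subgroup.relIndex_comap]
        refine Subgroup.relIndex_le_of_le_right ?_ (hne hWo hU)
        exact (Subgroup.map_mono inf_le_left).trans (Subgroup.map_comap_le f U)
    _ = _ := by ring

variable [T2Space G]

/-- Factor `α^[n] x` and pull its `posAll` part back through `W` to `z`. Then `z⁻¹ * x` is in `W`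
and eventually stays in `W`, so tidiness keeps its whole orbit there. -/
lemma IsTidy.negTrunc_eq (h : IsTidy α W) (n : ℕ) :
    negTrunc α W n = W.comap (iterHom α n) ⊓ W := by
  refine le_antisymm (fun x hx => ⟨hx n le_rfl, hx 0 (Nat.zero_le n)⟩) ?_
  rintro x ⟨hxn, hx⟩
  obtain ⟨y, hy, hyx⟩ := h.isTidyAbove.exists_mul h.isCompact h.isOpen hxn
  obtain ⟨z, hz, hzn, rfl⟩ := exists_posAll_iterate_eq hy n
  have hzx : z⁻¹ * x ∈ negAll α W := by
    refine h.inf_negEv_le ⟨W.mul_mem (W.inv_mem (posAll_le hz)) hx, ?_⟩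
    refine (iterate_mem_negEv_iff n).mp ?_
    rw [iterate_mul, iterate_inv]
    exact negAll_le_negEv hyx
  have := mul_mem hzn (negAll_le_negTrunc n hzx)
  rwa [mul_inv_cancel_left] at this

lemma IsTidy.relIndex_comap (h : IsTidy α W) (n : ℕ) :
    (W.comap (iterHom α n)).relIndex W = displacementIndex α W ^ n := by
  rw [← h.isTidyAbove.relIndex, h.negTrunc_eq, Subgroup.inf_relIndex_right]

/-- For tidy `W` the index grows exactly like the powers of its displacement index; a smaller
displacement index elsewhere would bound these powers by a constant times powers of a smaller base.
-/
lemma IsTidy.isMinimizing (h : IsTidy α W) : IsMinimizing α W := by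
  refine isMinimizing_of_le h.isCompact h.isOpen fun U hc ho => ?_
  by_contra! hlt
  have hpow : ∀ n, displacementIndex α W ^ n ≤
      U.relIndex W * W.relIndex U * displacementIndex α U ^ n := by
    intro n
    rw [← h.relIndex_comap]
    refine (relIndex_comap_iterate_le hc ho h.isCompact h.isOpen n).trans
      (Nat.mul_le_mul_left _ ((Subgroup.relIndex_le_of_le_left ?_ ?_).trans
        (relIndex_negTrunc_le_pow hc ho n)))
    · exact (negTrunc_le_comap_inf n).trans inf_le_left
    · exact relIndex_ne_zero_of_isOpen_of_isCompact (isOpen_negTrunc ho n) hc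
  have hpos : 0 < displacementIndex α U := by
    rw [displacementIndex_eq_relIndex]
    exact Nat.pos_of_ne_zero
      (relIndex_ne_zero_of_isOpen_of_isCompact (isOpen_negTrunc ho 1) hc)
  set C := U.relIndex W * W.relIndex U
  set a := displacementIndex α U
  set b := displacementIndex α W
  have ha : (0 : ℝ) < a := by exact_mod_cast hpos
  have hr : (1 : ℝ) < b / a := by
    rw [one_lt_div ha]
    exact_mod_cast hlt
  obtain ⟨n, hn⟩ := pow_unbounded_of_one_lt (C : ℝ) hr
  rw [div_pow, lt_div_iff₀ (pow_pos ha n)] at hn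
  exact absurd (hpow n) (not_le.mpr (by exact_mod_cast hn))

/-- If an orbit leaves `U` and returns for good, points spaced along a regressive sequence give
arbitrarily many cosets of `negTrunc α U n`. -/
lemma IsTidyAbove.isTidy_of_relIndex_le (h : IsTidyAbove α U) (hc : IsCompact (U : Set G))
    (ho : IsOpen (U : Set G)) {C : ℕ}
    (hC : ∀ n, (negTrunc α U n).relIndex (U.comap (iterHom α n) ⊓ U) ≤ C) : IsTidy α U := by
  refine ⟨hc, ho, h, ?_⟩
  rintro x ⟨hx, hxev⟩
  obtain ⟨z, hz, hzx⟩ := h.exists_mul hc ho hx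
  suffices hzU : z ∈ negAll α U by
    have := mul_mem hzU hzx
    rwa [mul_inv_cancel_left] at this
  have hzev : z ∈ negEv α U := by
    have := (negEv α U).mul_mem hxev (inv_mem (negAll_le_negEv hzx))
    simpa using this
  by_contra hzU
  rw [mem_negAll, not_forall] at hzU
  obtain ⟨a, ha⟩ := hzU
  obtain ⟨N, hN⟩ := hzev
  obtain ⟨u, hu, huU⟩ := hz
  have haN : a < N := not_le.mp fun h => ha (hN a h)
  let n := (C + 1) * N
  have hle : C + 1 ≤ (negTrunc α U n).relIndex (U.comap (iterHom α n) ⊓ U) := by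
    have hmul : ∀ i : Fin (C + 1), (i : ℕ) * N + N ≤ n := fun i => by
      have : ((i : ℕ) + 1) * N ≤ n := Nat.mul_le_mul_right N i.2
      linarith
    refine le_relIndex_of_pairwise (fun i => u (i * N)) (fun i => ⟨?_, huU _⟩) ?_ ?_
    · have hi := hmul i
      change α^[n] (u (i * N)) ∈ U
      rw [show n = (n - i * N) + i * N by omega, Function.iterate_add_apply, hu.iterate_eq]
      exact hN _ (by omega)
    · intro i j hij hmem
      have hi := hmul i
      have hj : (i : ℕ) * N + N ≤ j * N := by
        have : ((i : ℕ) + 1) * N ≤ j * N := Nat.mul_le_mul_right N hij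
        linarith
      -- At time `a + i * N` the `i`th point has reached `α^[a] z`, outside `U`, while the `j`th is
      -- still on the regressive part inside `U`.
      have h1 := hmem (a + i * N) (by omega)
      rw [iterate_mul, iterate_inv, Function.iterate_add_apply α a, hu.iterate_eq,
        show (j : ℕ) * N = (j * N - (a + i * N)) + (a + i * N) by omega, hu.iterate] at h1
      refine ha ?_
      have := U.mul_mem (huU (j * N - (a + i * N))) (U.inv_mem h1)
      simpa using this
    · exact relIndex_ne_zero_of_isOpen_of_isCompact (isOpen_negTrunc ho n)
        (hc.inter_left (Subgroup.isClosed_of_isOpen _ (ho.preimage (continuous_iterate α n))))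
  exact absurd (hle.trans (hC n)) (by omega)

/-- With equal displacement indices, comparison with `W` leaves only a bounded defect `p` between
`negTrunc α U n` and `U ∩ α⁻ⁿ(U)`. -/
lemma IsMinimizing.isTidy (h : IsMinimizing α U) (hW : IsTidy α W) : IsTidy α U := by
  have hd : displacementIndex α U = displacementIndex α W := by
    rw [h.index_eq, hW.isMinimizing.index_eq]
  refine h.isTidyAbove.isTidy_of_relIndex_le h.isCompact h.isOpen
    (C := U.relIndex W * W.relIndex U) fun n => ?_
  set p := (negTrunc α U n).relIndex (U.comap (iterHom α n) ⊓ U)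
  set q := (U.comap (iterHom α n)).relIndex U
  have hpq : p * q = displacementIndex α W ^ n := by
    rw [← hd, ← h.isTidyAbove.relIndex, Subgroup.relIndex_inf_mul_relIndex,
      inf_eq_left.mpr ((negTrunc_le_comap_inf n).trans inf_le_left)]
  have hle := relIndex_comap_iterate_le (α := α) h.isCompact h.isOpen hW.isCompact hW.isOpen n
  rw [hW.relIndex_comap, ← hpq] at hle
  exact Nat.le_of_mul_le_mul_right hle (Nat.pos_of_ne_zero
    (relIndex_ne_zero_of_isOpen_of_isCompact (H := U.comap (iterHom α n))
      (h.isOpen.preimage (continuous_iterate α n))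
      h.isCompact))

end Scale

/-! ### Finite-index subgroups and surjective endomorphisms -/

section CompactGroup

variable {P : Type*} [Group P] {φ : P →* P} {D : Subgroup P}

/-- Preimages under a surjection keep the index, and nested subgroups of the same finite index
coincide. -/
lemma comap_eq_of_comap_le (hφ : Function.Surjective φ) (hD : D.index ≠ 0)
    (h : D.comap φ ≤ D) : D.comap φ = D := by
  have hi := Subgroup.index_comap_of_surjective D hφ
  have : (D.comap φ).FiniteIndex := ⟨hi ▸ hD⟩
  by_contra hne
  exact absurd hi (Subgroup.index_strictAnti (lt_of_le_of_ne h hne)).ne'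

lemma comap_eq_of_le_comap (hφ : Function.Surjective φ) (hD : D.index ≠ 0)
    (h : D ≤ D.comap φ) : D.comap φ = D := by
  have hi := Subgroup.index_comap_of_surjective D hφ
  have : D.FiniteIndex := ⟨hD⟩
  by_contra hne
  exact absurd hi (Subgroup.index_strictAnti (lt_of_le_of_ne h (Ne.symm hne))).ne

/-- If `D` is its own preimage and has finite index then every orbit is periodic modulo `D`. -/
lemma exists_iterate_periodic [D.Normal] (hD : D.index ≠ 0) (h : D.comap φ = D) (x : P) :
    ∃ k > 0, ∀ n, x⁻¹ * φ^[k * n] x ∈ D := by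
  have hf : Finite (P ⧸ D) := Nat.finite_of_card_ne_zero hD
  let f := QuotientGroup.map D D φ h.ge
  have hinj : Function.Injective f := by
    rw [injective_iff_map_eq_one]
    intro q
    obtain ⟨y, rfl⟩ := QuotientGroup.mk_surjective q
    intro hq
    have hy : φ y ∈ D := (QuotientGroup.eq_one_iff _).mp hq
    rw [← Subgroup.mem_comap, h] at hy
    exact (QuotientGroup.eq_one_iff _).mpr hy
  have hiter : ∀ n (y : P), f^[n] (y : P ⧸ D) = ((φ^[n] y : P) : P ⧸ D) := by
    intro n
    induction n with
    | zero => exact fun y => rfl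
    | succ n ih => exact fun y => ih (φ y)
  obtain ⟨k, hk, hper⟩ := Function.mem_periodicPts.mp (hinj.mem_periodicPts (x : P ⧸ D))
  refine ⟨k, hk, fun n => QuotientGroup.eq.mp ?_⟩
  rw [← hiter]
  exact (hper.mul_const n).eq.symm

end CompactGroup

/-! ### Surjective endomorphisms of compact groups -/

section CompactTopologicalGroup

variable {P : Type*} [Group P] [TopologicalSpace P] [IsTopologicalGroup P] [CompactSpace P]

lemma index_ne_zero_of_isOpen {D : Subgroup P} (hD : IsOpen (D : Set P)) : D.index ≠ 0 := by
  have := Subgroup.quotient_finite_of_isOpen D hD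
  exact Subgroup.finiteIndex_iff.mp Subgroup.finiteIndex_of_finite_quotient

variable [T2Space P] {φ : P →ₜ* P} {B : Subgroup P}

/-- In a compact group, an open normal tidy above subgroup `B` generates, together with its
homoclinic elements, an open normal subgroup on whose quotient `φ` induces an automorphism. -/
lemma exists_normal_comap_eq (hφ : Function.Surjective φ) [hBn : B.Normal]
    (hBo : IsOpen (B : Set P)) (hB : IsTidyAbove φ B) :
    ∃ D : Subgroup P, D.Normal ∧ D.index ≠ 0 ∧ D.comap φ.toMonoidHom = D ∧
      ∀ x ∈ D, ∃ b ∈ B, ∃ y ∈ homoclinic φ B, b * y = x := by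
  have hBc : IsCompact (B : Set P) := (Subgroup.isClosed_of_isOpen _ hBo).isCompact
  have hnorm : (negEv φ B).Normal := by
    refine ⟨fun x hx g => ?_⟩
    obtain ⟨m, hm⟩ := hx
    refine ⟨m, fun k hk => ?_⟩
    rw [iterate_mul, iterate_mul, iterate_inv]
    exact hBn.conj_mem _ (hm k hk) _
  have hDneg : (B ⊔ negEv φ B).index ≠ 0 :=
    index_ne_zero_of_isOpen (Subgroup.isOpen_mono le_sup_left hBo)
  have hDpos : (B ⊔ posEv φ B).index ≠ 0 :=
    index_ne_zero_of_isOpen (Subgroup.isOpen_mono le_sup_left hBo)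
  have hpos : (B ⊔ posEv φ B).comap φ.toMonoidHom = B ⊔ posEv φ B := by
    refine comap_eq_of_le_comap hφ hDpos (sup_le ?_ ?_)
    · intro b hb
      obtain ⟨z, hz, hzb⟩ := hB.exists_mul hBc hBo hb
      have h₁ : φ z ∈ B ⊔ posEv φ B :=
        le_sup_right (a := B) (map_mem_posEv (posAll_le_posEv hz))
      have h₂ : φ (z⁻¹ * b) ∈ B ⊔ posEv φ B := le_sup_left (a := B) (hzb 1)
      have := mul_mem h₁ h₂
      rwa [← map_mul, mul_inv_cancel_left] at this
    · exact fun x hx => le_sup_right (a := B) (map_mem_posEv hx)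
  refine ⟨B ⊔ negEv φ B, inferInstance, hDneg, comap_eq_of_comap_le hφ hDneg ?_, ?_⟩
  · intro x hx
    obtain ⟨b, hb, y, hy, hbx⟩ := Subgroup.mem_sup_of_normal_left.mp hx
    obtain ⟨z, hz, hzb⟩ := hB.exists_mul hBc hBo hb
    obtain ⟨z', hz', -, hzz⟩ := exists_posAll_iterate_eq hz 1
    have : z'⁻¹ * x ∈ negEv φ B := by
      rw [← map_mem_negEv_iff, map_mul, map_inv, show φ z' = z from hzz,
        show φ x = b * y from hbx.symm, ← mul_assoc]
      exact mul_mem (negAll_le_negEv hzb) hy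
    have := mul_mem (le_sup_left (b := negEv φ B) (posAll_le hz'))
      (le_sup_right (a := B) this)
    rwa [mul_inv_cancel_left] at this
  · intro x hx
    obtain ⟨b, hb, y, hy, rfl⟩ := Subgroup.mem_sup_of_normal_left.mp hx
    -- Some iterate of `y` is in `B`, and `B ⊔ posEv φ B` is its own preimage, so membership
    -- descends to `y`.
    have hyD : y ∈ B ⊔ posEv φ B := by
      obtain ⟨m, hm⟩ := hy
      have key : ∀ n, φ^[n] y ∈ B ⊔ posEv φ B → y ∈ B ⊔ posEv φ B := by
        intro n
        induction n with
        | zero => exact id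
        | succ n ih =>
          intro h
          refine ih ?_
          rw [Function.iterate_succ_apply'] at h
          rw [← hpos]
          exact h
      exact key m (le_sup_left (a := B) (hm m le_rfl))
    obtain ⟨c, hc, p, hp, rfl⟩ := Subgroup.mem_sup_of_normal_left.mp hyD
    obtain ⟨z, hz, hzc⟩ := hB.exists_mul hBc hBo (inv_mem hc)
    -- `c = v * z⁻¹` with `v` having its forward orbit in `B`
    have hv : (z⁻¹ * c⁻¹)⁻¹ ∈ negAll φ B := inv_mem hzc
    refine ⟨b * (z⁻¹ * c⁻¹)⁻¹, mul_mem hb (negAll_le hv), z⁻¹ * p,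
      ⟨(posEv φ B).mul_mem (inv_mem (posAll_le_posEv hz)) hp, ?_⟩, by group⟩
    have := (negEv φ B).mul_mem (negAll_le_negEv hzc) hy
    rwa [mul_assoc, inv_mul_cancel_left] at this

end CompactTopologicalGroup

/-! ### Restriction to an invariant subgroup -/

section Restriction

variable {G : Type*} [Group G] [TopologicalSpace G]

/-- The restriction of `α` to a subgroup mapped into itself. -/
def restrictHom (α : G →ₜ* G) (P : Subgroup G) (hP : P.map α.toMonoidHom ≤ P) : P →ₜ* P where
  toMonoidHom := (α.toMonoidHom.comp P.subtype).codRestrict P fun x => hP ⟨x, x.2, rfl⟩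
  continuous_toFun := by
    refine Continuous.subtype_mk ((map_continuous α).comp continuous_subtype_val) _

variable {α : G →ₜ* G} {P : Subgroup G} {hP : P.map α.toMonoidHom ≤ P}

lemma coe_restrictHom_iterate (n : ℕ) (x : P) :
    (((restrictHom α P hP)^[n] x : P) : G) = α^[n] x := by
  induction n generalizing x with
  | zero => rfl
  | succ n ih => exact ih _

lemma coe_mem_homoclinic {B : Subgroup P} {V : Subgroup G} (h : ∀ b ∈ B, (b : G) ∈ V) {x : P}
    (hx : x ∈ homoclinic (restrictHom α P hP) B) : (x : G) ∈ homoclinic α V := by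
  obtain ⟨⟨u, hu, m, hm⟩, ⟨n, hn⟩⟩ := hx
  refine ⟨⟨fun k => u k, ⟨congrArg Subtype.val hu.zero, fun k => ?_⟩, m,
    fun k hk => h _ (hm k hk)⟩, n, fun k hk => ?_⟩
  · exact congrArg Subtype.val (hu.succ k)
  · rw [← coe_restrictHom_iterate (hP := hP)]
    exact h _ (hn k hk)

end Restriction

/-! ### Existence of tidy subgroups -/

section Tidying

variable {G : Type*} [Group G] [TopologicalSpace G] [IsTopologicalGroup G] [T2Space G]
  {α : G →ₜ* G} {V W : Subgroup G}

/-- A tidy above subgroup containing the homoclinic elements of some open subgroup is tidy. -/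
lemma IsTidyAbove.isTidy_of_homoclinic_le (h : IsTidyAbove α W) (hc : IsCompact (W : Set G))
    (ho : IsOpen (W : Set G)) (hVo : IsOpen (V : Set G)) (hVW : homoclinic α V ≤ W) :
    IsTidy α W := by
  refine ⟨hc, ho, h, ?_⟩
  rintro x ⟨hx, hxev⟩
  obtain ⟨z, hz, hzx⟩ := h.exists_mul hc ho hx
  suffices hzW : z ∈ negAll α W by
    have := mul_mem hzW hzx
    rwa [mul_inv_cancel_left] at this
  have hzev : z ∈ negEv α W := by
    have := (negEv α W).mul_mem hxev (inv_mem (negAll_le_negEv hzx))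
    simpa using this
  let P := (homoclinic α W).topologicalClosure
  have hPc : CompactSpace P :=
    isCompact_iff_compactSpace.mp (isCompact_homoclinic_topologicalClosure hc ho)
  have hPα : P.map α.toMonoidHom = P := map_homoclinic_topologicalClosure hc ho
  let φ := restrictHom α P hPα.le
  have hφ : Function.Surjective φ := by
    rintro ⟨y, hy⟩
    obtain ⟨x, hx, hxy⟩ := hPα.ge hy
    exact ⟨⟨x, hx⟩, Subtype.ext hxy⟩
  -- The normal core of `A` is open in the compact group `P`; truncating it gives a normal tidy
  -- above `B` whose homoclinic elements are among those of `V`, hence in `W`.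
  let A : Subgroup P := (V ⊓ W).subgroupOf P
  have hAo : IsOpen (A : Set P) := (hVo.inter ho).preimage continuous_subtype_val
  have : A.FiniteIndex := ⟨index_ne_zero_of_isOpen hAo⟩
  have hNo : IsOpen (A.normalCore : Set P) := Subgroup.isOpen_of_isClosed_of_finiteIndex _
    (A.normalCore_isClosed (A.isClosed_of_isOpen hAo))
  obtain ⟨n, hn⟩ := exists_isTidyAbove_negTrunc (α := φ)
    (Subgroup.isClosed_of_isOpen _ hNo).isCompact hNo
  have hnorm : (negTrunc φ A.normalCore n).Normal := by
    refine ⟨fun x hx g k hk => ?_⟩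
    rw [iterate_mul, iterate_mul, iterate_inv]
    exact (A.normalCore_normal).conj_mem _ (hx k hk) _
  have hBA : ∀ b ∈ negTrunc φ A.normalCore n, (b : G) ∈ V ⊓ W := fun b hb =>
    A.normalCore_le (negTrunc_le n hb)
  obtain ⟨D, hDn, hDi, hD, hDB⟩ := exists_normal_comap_eq hφ (isOpen_negTrunc hNo n) hn
  have hDW : ∀ d ∈ D, (d : G) ∈ W := by
    intro d hd
    obtain ⟨b, hb, y, hy, rfl⟩ := hDB d hd
    exact mul_mem (hBA b hb).2 (hVW (coe_mem_homoclinic (fun b hb => (hBA b hb).1) hy))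
  have hzP : z ∈ P := Subgroup.le_topologicalClosure _ ⟨posAll_le_posEv hz, hzev⟩
  intro j
  -- Modulo `D`, which lies in `W`, the orbit is periodic; being eventually in `W`, it is in `W`
  -- throughout.
  obtain ⟨k, hk, hper⟩ := exists_iterate_periodic hDi hD (φ^[j] ⟨z, hzP⟩)
  obtain ⟨m, hm⟩ := hzev
  have h₁ := hDW _ (hper m)
  have h₂ : ((φ^[k * m] (φ^[j] ⟨z, hzP⟩) : P) : G) ∈ W := by
    rw [← Function.iterate_add_apply, coe_restrictHom_iterate]
    exact hm _ (by nlinarith)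
  have h₃ : ((φ^[j] ⟨z, hzP⟩ : P) : G) ∈ W := by
    have := W.mul_mem h₂ (W.inv_mem h₁)
    rw [Subgroup.coe_mul, Subgroup.coe_inv] at this
    simpa using this
  rwa [coe_restrictHom_iterate] at h₃

/-- The homoclinic closure is invariant, so it survives in every truncation of `O`, in particular in
one that is tidy above. -/
lemma exists_isTidy_le {O : Subgroup G} (hVo : IsOpen (V : Set G))
    (hVc : IsCompact (V : Set G)) (hc : IsCompact (O : Set G)) (ho : IsOpen (O : Set G))
    (hVO : (homoclinic α V).topologicalClosure ≤ O) : ∃ W ≤ O, IsTidy α W := by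
  obtain ⟨n, hn⟩ := exists_isTidyAbove_negTrunc (α := α) hc ho
  refine ⟨_, negTrunc_le n, hn.isTidy_of_homoclinic_le (isCompact_negTrunc hc ho n)
    (isOpen_negTrunc ho n) hVo ?_⟩
  exact (Subgroup.le_topologicalClosure _).trans (le_negTrunc_of_map_le
    (map_homoclinic_topologicalClosure hVc hVo).le hVO n)

variable [LocallyCompactSpace G] [TotallyDisconnectedSpace G]

lemma exists_isTidy (α : G →ₜ* G) : ∃ W, IsTidy α W := by
  obtain ⟨V, hVc, hVo, -⟩ := exists_isCompact_isOpen_subgroup_subset (G := G) Filter.univ_mem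
  obtain ⟨O, hOc, hOo, hVO, -⟩ := exists_isCompact_isOpen_subgroup_between
    (isCompact_homoclinic_topologicalClosure (α := α) hVc hVo) hVc hVo
  obtain ⟨W, -, hW⟩ := exists_isTidy_le hVo hVc hOc hOo hVO
  exact ⟨W, hW⟩

lemma isMinimizing_iff_isTidy : IsMinimizing α W ↔ IsTidy α W :=
  ⟨fun h => h.isTidy (exists_isTidy α).choose_spec, IsTidy.isMinimizing⟩

lemma nub_le_homoclinic_topologicalClosure (hVc : IsCompact (V : Set G))
    (hVo : IsOpen (V : Set G)) : nub α ≤ (homoclinic α V).topologicalClosure := by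
  intro x hx
  refine mem_of_forall_mem_isCompact_isOpen (isCompact_homoclinic_topologicalClosure hVc hVo)
    fun O hOc hOo hVO => ?_
  obtain ⟨W, hWO, hW⟩ := exists_isTidy_le hVo hVc hOc hOo hVO
  exact hWO (Subgroup.mem_sInf.mp hx W hW.isMinimizing)

end Tidying

/-! ### Tidy subgroups and the anti-parabolic subgroup -/

section Parabolic

variable {G : Type*} [Group G] [TopologicalSpace G]
  {α : G →ₜ* G} {U : Subgroup G}

lemma normal_iteratedKernel (α : G →ₜ* G) : (iteratedKernel α).Normal := by
  refine ⟨fun x hx g => ?_⟩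
  obtain ⟨n, hn⟩ := hx
  exact ⟨n, by rw [iterate_mul, iterate_mul, iterate_inv, hn, mul_one, mul_inv_cancel]⟩

lemma map_mem_iteratedKernel_iff {α : G →ₜ* G} {x : G} :
    α x ∈ iteratedKernel α ↔ x ∈ iteratedKernel α := by
  constructor
  · rintro ⟨n, hn⟩
    exact ⟨n + 1, hn⟩
  · rintro ⟨n, hn⟩
    refine ⟨n, ?_⟩
    rw [← Function.iterate_succ_apply, Function.iterate_succ_apply', hn, map_one]

variable [IsTopologicalGroup G]

lemma iteratedKernel_inf_parMinus_le_ik (α : G →ₜ* G) :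
    iteratedKernel α ⊓ parMinus α ≤ ik α := Subgroup.le_topologicalClosure _

lemma posEv_le_parMinus (hc : IsCompact (U : Set G)) : posEv α U ≤ parMinus α := by
  rintro x ⟨u, hu, m, hm⟩
  refine ⟨u, hu, (hc.union ((Set.finite_lt_nat m).image u).isCompact).closure_of_subset ?_⟩
  rintro _ ⟨n, rfl⟩
  rcases lt_or_ge n m with h | h
  · exact Or.inr ⟨n, h, rfl⟩
  · exact Or.inl (hm n h)

/-- Inside the open group `U` it coincides with the closed group `negAll α U`, and a locally closed
subgroup is closed. -/
lemma IsTidy.isClosed_negEv (h : IsTidy α U) : IsClosed (negEv α U : Set G) := by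
  have hcl : IsClosed (negAll α U : Set G) :=
    isClosed_negAll (Subgroup.isClosed_of_isOpen _ h.isOpen)
  refine isClosed_of_closure_subset fun x hx => ?_
  obtain ⟨y, ⟨g, hg, rfl⟩, hy⟩ := mem_closure_iff_nhds.mp hx (x • (U : Set G))
    ((h.isOpen.smul x).mem_nhds ⟨1, U.one_mem, by simp⟩)
  change x * g ∈ negEv α U at hy
  have hg' : g ∈ (negEv α U).topologicalClosure := by
    have := mul_mem (inv_mem (show x ∈ (negEv α U).topologicalClosure from hx))
      ((negEv α U).le_topologicalClosure hy)
    rwa [inv_mul_cancel_left] at this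
  have hgU : g ∈ closure ((U : Set G) ∩ negEv α U) :=
    h.isOpen.inter_closure ⟨hg, hg'⟩
  have hgn : g ∈ negAll α U := (closure_minimal h.inf_negEv_le hcl) hgU
  have := mul_mem hy (inv_mem (negAll_le_negEv hgn))
  change x ∈ negEv α U
  rwa [mul_inv_cancel_right] at this

lemma isStable_lev (α : G →ₜ* G) : IsStable α (lev α) := by
  apply le_antisymm
  · rintro _ ⟨x, ⟨hx, hx'⟩, rfl⟩
    refine ⟨IsCompact.closure_of_subset hx ?_, map_mem_parMinus α hx'⟩
    rintro _ ⟨n, rfl⟩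
    exact subset_closure ⟨n + 1, rfl⟩
  · rintro x ⟨hx, u, hu, hub⟩
    have hu1 : α (u 1) = x := by rw [← hu.zero]; exact hu.succ 0
    refine ⟨u 1, ⟨?_, _, hu.shift 1, IsCompact.closure_of_subset hub ?_⟩, hu1⟩
    · refine (IsCompact.union hx (isCompact_singleton (x := u 1))).closure_of_subset ?_
      rintro _ ⟨n, rfl⟩
      cases n with
      | zero => exact Or.inr rfl
      | succ n =>
        refine Or.inl (subset_closure ⟨n, ?_⟩)
        change α^[n] x = α^[n] (α (u 1))
        rw [hu1]
    · rintro _ ⟨n, rfl⟩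
      exact subset_closure ⟨_, rfl⟩

lemma le_lev_of_isStable {H : Subgroup G} (hc : IsCompact (H : Set G)) (hH : IsStable α H) :
    H ≤ lev α := by
  intro x hx
  constructor
  · refine hc.closure_of_subset ?_
    rintro _ ⟨n, rfl⟩
    exact le_negTrunc_of_map_le (U := H) hH.le le_rfl n hx n le_rfl
  · have hex : ∀ y : H, ∃ z : H, α z = y := fun y => by
      obtain ⟨z, hz, hzy⟩ := hH.ge y.2
      exact ⟨⟨z, hz⟩, hzy⟩
    choose s hs using hex
    refine ⟨fun n => (s^[n] ⟨x, hx⟩ : H), ⟨rfl, fun n => ?_⟩, hc.closure_of_subset ?_⟩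
    · rw [Function.iterate_succ_apply', hs]
    · rintro _ ⟨n, rfl⟩
      exact (s^[n] ⟨x, hx⟩ : H).2

/-- The closure of a bounded regressive sequence is a compact subset of `negEv α U`, so one time `M`
brings all of it into `negAll α U`; the term `u n` is the `M`th iterate of `u (n + M)`. -/
lemma IsTidy.exists_isRegressive (h : IsTidy α U) {x : G} (hx : x ∈ parMinus α)
    (hxU : x ∈ negEv α U) : ∃ u, IsRegressive α x u ∧ ∀ n, u n ∈ negAll α U := by
  obtain ⟨u, hu, hub⟩ := hx
  have hsub : closure (Set.range u) ⊆ negEv α U := by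
    refine closure_minimal ?_ h.isClosed_negEv
    rintro _ ⟨n, rfl⟩
    change u n ∈ negEv α U
    rwa [← iterate_mem_negEv_iff n, hu.iterate_eq]
  have hin : ∀ N, ∀ c ∈ negEv α U, α^[N] c ∈ U → α^[N] c ∈ negAll α U := fun N c hc hcU =>
    h.inf_negEv_le ⟨hcU, (iterate_mem_negEv_iff N).mpr hc⟩
  obtain ⟨F, hF⟩ := IsCompact.elim_finite_subcover hub (fun N : ℕ => α^[N] ⁻¹' (U : Set G))
    (fun N => h.isOpen.preimage (continuous_iterate α N)) (fun c hc => by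
      obtain ⟨m, hm⟩ := hsub hc
      exact Set.mem_iUnion.mpr ⟨m, hm m le_rfl⟩)
  obtain ⟨M, hM⟩ := F.bddAbove
  refine ⟨u, hu, fun n => ?_⟩
  have hmem : u (n + M) ∈ closure (Set.range u) := subset_closure ⟨_, rfl⟩
  obtain ⟨N, hN, hNU⟩ := Set.mem_iUnion₂.mp (hF hmem)
  have := iterate_mem_negAll (hin N _ (hsub hmem) hNU) (M - N)
  rwa [← Function.iterate_add_apply, Nat.sub_add_cancel (hM hN), hu.iterate] at this

lemma IsTidy.topologicalClosure_iteratedKernel_le (h : IsTidy α U) :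
    (iteratedKernel α).topologicalClosure ≤ negEv α U := by
  refine Subgroup.topologicalClosure_minimal _ ?_ h.isClosed_negEv
  rintro x ⟨n, hn⟩
  rw [← iterate_mem_negEv_iff n, hn]
  exact one_mem _

lemma isInvariant_topologicalClosure_iteratedKernel_inf_parMinus (α : G →ₜ* G) :
    IsInvariant α ((iteratedKernel α).topologicalClosure ⊓ parMinus α) := by
  rintro _ ⟨x, ⟨hx, hxm⟩, rfl⟩
  refine ⟨?_, map_mem_parMinus α hxm⟩
  have : (iteratedKernel α).topologicalClosure ≤
      (iteratedKernel α).topologicalClosure.comap α.toMonoidHom :=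
    Subgroup.topologicalClosure_minimal _ (fun y hy => Subgroup.le_topologicalClosure _
      (map_mem_iteratedKernel_iff.mpr hy))
      ((Subgroup.isClosed_topologicalClosure _).preimage (map_continuous α))
  exact this hx

lemma normal_subgroupOf_topologicalClosure_iteratedKernel_inf_parMinus (α : G →ₜ* G) :
    (((iteratedKernel α).topologicalClosure ⊓ parMinus α).subgroupOf (parMinus α)).Normal := by
  have := normal_iteratedKernel α
  have := Subgroup.is_normal_topologicalClosure (iteratedKernel α)
  rw [Subgroup.inf_subgroupOf_right]
  infer_instance

lemma normal_ikInParMinus (α : G →ₜ* G) : (ikInParMinus α).Normal := by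
  have hn := normal_iteratedKernel α
  refine ⟨fun x hx g => ?_⟩
  have hle : ik α ≤ (ik α).comap (MulAut.conj (g : G)).toMonoidHom := by
    refine Subgroup.topologicalClosure_minimal _ ?_ ((Subgroup.isClosed_topologicalClosure _).preimage
      (show Continuous fun y => (g : G) * y * (g : G)⁻¹ by fun_prop))
    rintro y ⟨hy, hym⟩
    exact iteratedKernel_inf_parMinus_le_ik α ⟨hn.conj_mem y hy g,
      (parMinus α).mul_mem ((parMinus α).mul_mem g.2 hym) (inv_mem g.2)⟩
  exact hle hx

lemma IsTidy.parMinus_inf_negEv_le (h : IsTidy α U) : parMinus α ⊓ negEv α U ≤ U := by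
  rintro x ⟨hx, hxU⟩
  obtain ⟨u, hu, huU⟩ := h.exists_isRegressive hx hxU
  exact hu.zero ▸ negAll_le (huU 0)

variable [T2Space G]

lemma IsTidy.inf_parMinus (h : IsTidy α U) : U ⊓ parMinus α = posAll α U := by
  refine le_antisymm ?_ (le_inf posAll_le (posAll_le_posEv.trans (posEv_le_parMinus h.isCompact)))
  rintro x ⟨hxU, hx⟩
  obtain ⟨z, hz, hzx⟩ := h.isTidyAbove.exists_mul h.isCompact h.isOpen hxU
  have hzm : z ∈ parMinus α := posEv_le_parMinus h.isCompact (posAll_le_posEv hz)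
  obtain ⟨u, hu, huU⟩ := h.exists_isRegressive ((parMinus α).mul_mem (inv_mem hzm) hx)
    (negAll_le_negEv hzx)
  have := mul_mem hz (show z⁻¹ * x ∈ posAll α U from ⟨u, hu, fun n => negAll_le (huU n)⟩)
  rwa [mul_inv_cancel_left] at this

end Parabolic

/-! ### The nub, the bounded iterated kernel and the quotient -/

section Nub

variable {G : Type*} [Group G] [TopologicalSpace G] [IsTopologicalGroup G] [T2Space G]
  [LocallyCompactSpace G] [TotallyDisconnectedSpace G]

lemma isCompact_nub (α : G →ₜ* G) : IsCompact (nub α : Set G) := by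
  obtain ⟨W, hW⟩ := exists_isTidy α
  refine hW.isCompact.of_isClosed_subset ?_ (show nub α ≤ W from sInf_le hW.isMinimizing)
  rw [nub, Subgroup.coe_sInf]
  exact isClosed_biInter fun V hV => Subgroup.isClosed_of_isOpen _ hV.isOpen

lemma IsMinimizing.homoclinic_topologicalClosure_le {α : G →ₜ* G} {U : Subgroup G}
    (h : IsMinimizing α U) : (homoclinic α U).topologicalClosure ≤ U := by
  have hU := isMinimizing_iff_isTidy.mp h
  refine Subgroup.topologicalClosure_minimal _ ?_ (Subgroup.isClosed_of_isOpen _ h.isOpen)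
  exact fun x hx => hU.parMinus_inf_negEv_le ⟨posEv_le_parMinus h.isCompact hx.1, hx.2⟩

lemma isStable_nub (α : G →ₜ* G) : IsStable α (nub α) := by
  apply le_antisymm
  · rintro _ ⟨x, hx, rfl⟩
    refine Subgroup.mem_sInf.mpr fun U hU => ?_
    exact Subgroup.mem_sInf.mp hx _ (IsMinimizing.isMinimizing_negTrunc hU 1) 1 le_rfl
  · intro x hx
    -- Every homoclinic closure is stable and contains `x`. The preimages of `x` in these compact
    -- groups form a directed family, as `homoclinic` is monotone, so they share a point.
    let ι := {V : Subgroup G // IsCompact (V : Set G) ∧ IsOpen (V : Set G)}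
    let S : ι → Set G := fun V => ((homoclinic α V.1).topologicalClosure : Set G) ∩ α ⁻¹' {x}
    have hS : ∀ V : ι, IsCompact (S V) := fun V =>
      (isCompact_homoclinic_topologicalClosure V.2.1 V.2.2).inter_right
        (isClosed_singleton.preimage (map_continuous α))
    obtain ⟨W, hW⟩ := exists_isTidy α
    have : Nonempty ι := ⟨⟨W, hW.isCompact, hW.isOpen⟩⟩
    obtain ⟨y, hy⟩ := IsCompact.nonempty_iInter_of_directed_nonempty_isCompact_isClosed S
      (fun V₁ V₂ => by
        refine ⟨⟨V₁.1 ⊓ V₂.1, V₁.2.1.inter_right (Subgroup.isClosed_of_isOpen _ V₂.2.2),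
          V₁.2.2.inter V₂.2.2⟩, ?_, ?_⟩
        · exact Set.inter_subset_inter_left _
            (Subgroup.topologicalClosure_mono (homoclinic_mono inf_le_left))
        · exact Set.inter_subset_inter_left _
            (Subgroup.topologicalClosure_mono (homoclinic_mono inf_le_right)))
      (fun V => by
        have := nub_le_homoclinic_topologicalClosure (α := α) V.2.1 V.2.2 hx
        rw [← map_homoclinic_topologicalClosure V.2.1 V.2.2] at this
        exact this)
      hS (fun V => (hS V).isClosed)
    rw [Set.mem_iInter] at hy
    refine ⟨y, Subgroup.mem_sInf.mpr fun U hU => ?_, (hy ⟨W, hW.isCompact, hW.isOpen⟩).2⟩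
    exact hU.homoclinic_topologicalClosure_le (hy ⟨U, hU.isCompact, hU.isOpen⟩).1

lemma nub_le_lev (α : G →ₜ* G) : nub α ≤ lev α :=
  le_lev_of_isStable (isCompact_nub α) (isStable_nub α)

lemma nub_le_parMinus (α : G →ₜ* G) : nub α ≤ parMinus α := (nub_le_lev α).trans inf_le_right

lemma topologicalClosure_iteratedKernel_inf_parMinus_le_nub (α : G →ₜ* G) :
    (iteratedKernel α).topologicalClosure ⊓ parMinus α ≤ nub α := by
  rintro x ⟨hx, hxm⟩
  refine Subgroup.mem_sInf.mpr fun U hU => ?_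
  have h := isMinimizing_iff_isTidy.mp hU
  exact h.parMinus_inf_negEv_le ⟨hxm, h.topologicalClosure_iteratedKernel_le hx⟩

lemma isCompact_topologicalClosure_iteratedKernel_inf_parMinus (α : G →ₜ* G) :
    IsCompact (((iteratedKernel α).topologicalClosure ⊓ parMinus α : Subgroup G) : Set G) := by
  have : (iteratedKernel α).topologicalClosure ⊓ parMinus α =
      (iteratedKernel α).topologicalClosure ⊓ nub α :=
    le_antisymm (le_inf inf_le_left (topologicalClosure_iteratedKernel_inf_parMinus_le_nub α))
      (inf_le_inf_left _ (nub_le_parMinus α))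
  rw [this]
  exact (isCompact_nub α).inter_left (Subgroup.isClosed_topologicalClosure _)

lemma ik_le_nub (α : G →ₜ* G) : ik α ≤ nub α := by
  refine Subgroup.topologicalClosure_minimal _ (le_trans ?_
    (topologicalClosure_iteratedKernel_inf_parMinus_le_nub α)) (isCompact_nub α).isClosed
  exact inf_le_inf_right _ (Subgroup.le_topologicalClosure _)

lemma ik_le_parMinus (α : G →ₜ* G) : ik α ≤ parMinus α :=
  (ik_le_nub α).trans (nub_le_parMinus α)

lemma isCompact_ik (α : G →ₜ* G) : IsCompact (ik α : Set G) :=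
  (isCompact_nub α).of_isClosed_subset (Subgroup.isClosed_topologicalClosure _) (ik_le_nub α)

lemma isStable_ik (α : G →ₜ* G) : IsStable α (ik α) := by
  refine map_topologicalClosure_eq ?_ (isCompact_ik α)
  apply le_antisymm
  · rintro _ ⟨x, ⟨hx, hxm⟩, rfl⟩
    exact ⟨map_mem_iteratedKernel_iff.mpr hx, map_mem_parMinus α hxm⟩
  · rintro x ⟨hx, u, hu, hub⟩
    have hu1 : α (u 1) = x := by rw [← hu.zero]; exact hu.succ 0
    refine ⟨u 1, ⟨?_, _, hu.shift 1, IsCompact.closure_of_subset hub ?_⟩, hu1⟩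
    · rw [← hu1] at hx
      exact map_mem_iteratedKernel_iff.mp hx
    · rintro _ ⟨n, rfl⟩
      exact subset_closure ⟨_, rfl⟩

lemma ikInParMinus_le_comap (α : G →ₜ* G) :
    ikInParMinus α ≤ (ikInParMinus α).comap (parMinusHom α) :=
  fun x hx => (isStable_ik α).le ⟨x, hx, rfl⟩

lemma ik_le_topologicalClosure_inf_parMinus (α : G →ₜ* G) :
    ik α ≤ (iteratedKernel α).topologicalClosure ⊓ parMinus α :=
  le_inf (Subgroup.topologicalClosure_mono inf_le_left) (ik_le_parMinus α)

/-- By stability `x` differs from an element of `ik α` by a kernel element of `parMinus α`, again in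
`ik α`. -/
lemma map_mem_ik_iff {α : G →ₜ* G} {x : G} (hx : x ∈ parMinus α) :
    α x ∈ ik α ↔ x ∈ ik α := by
  refine ⟨fun h => ?_, fun h => (isStable_ik α).le ⟨x, h, rfl⟩⟩
  obtain ⟨y, hy, hyx⟩ := (isStable_ik α).ge h
  have hk : x * y⁻¹ ∈ ik α := by
    refine iteratedKernel_inf_parMinus_le_ik α
      ⟨⟨1, ?_⟩, (parMinus α).mul_mem hx (inv_mem (ik_le_parMinus α hy))⟩
    change α (x * y⁻¹) = 1
    rw [map_mul, map_inv, show α y = α x from hyx, mul_inv_cancel]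
  have := mul_mem hk hy
  rwa [inv_mul_cancel_right] at this

/-- This is openness at the identity. The part of `posAll α U` outside `T` is compact and contains
no kernel element, so its image stays away from `1`; near `1`, preimages taken in `posAll α U` must
lie in `T`. -/
lemma exists_nhds_forall_exists_map_eq (α : G →ₜ* G) {T : Set G} (hT : IsOpen T)
    (hik : (ik α : Set G) ⊆ T) :
    ∃ N ∈ 𝓝 (1 : G), ∀ x ∈ N, x ∈ parMinus α → ∃ y ∈ parMinus α, y ∈ T ∧ α y = x := by
  obtain ⟨U, hU⟩ := exists_isTidy α
  have hE : IsCompact ((posAll α U : Set G) \ T) := (isCompact_posAll hU.isCompact).diff hT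
  refine ⟨(U : Set G) ∩ (α '' ((posAll α U : Set G) \ T))ᶜ, Filter.inter_mem
    (hU.isOpen.mem_nhds U.one_mem)
    ((hE.image (map_continuous α)).isClosed.isOpen_compl.mem_nhds ?_), ?_⟩
  · rintro ⟨y, ⟨hy, hyT⟩, hy1⟩
    refine hyT (hik (iteratedKernel_inf_parMinus_le_ik α ⟨⟨1, hy1⟩, ?_⟩))
    exact posEv_le_parMinus hU.isCompact (posAll_le_posEv hy)
  · rintro x ⟨hxU, hxE⟩ hx
    have hxp : x ∈ posAll α U := hU.inf_parMinus.le ⟨hxU, hx⟩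
    obtain ⟨y, hy, -, hyx⟩ := exists_posAll_iterate_eq hxp 1
    refine ⟨y, posEv_le_parMinus hU.isCompact (posAll_le_posEv hy), ?_, hyx⟩
    by_contra hyT
    exact hxE ⟨y, ⟨hy, hyT⟩, hyx⟩

lemma isHomeomorph_quotientMap (α : G →ₜ* G) [(ikInParMinus α).Normal] :
    IsHomeomorph (QuotientGroup.map (ikInParMinus α) (ikInParMinus α) (parMinusHom α)
      (ikInParMinus_le_comap α)) := by
  set f := QuotientGroup.map (ikInParMinus α) (ikInParMinus α) (parMinusHom α)
    (ikInParMinus_le_comap α)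
  have hcont : Continuous (parMinusHom α) :=
    Continuous.subtype_mk ((map_continuous α).comp continuous_subtype_val) _
  refine ⟨?_, ?_, ?_, ?_⟩
  · exact (QuotientGroup.isOpenQuotientMap_mk.isQuotientMap.continuous_iff).mpr
      (QuotientGroup.continuous_mk.comp hcont)
  · refine IsTopologicalGroup.isOpenMap_iff_nhds_one.mpr fun S hS => ?_
    obtain ⟨T₀, hT₀S, hT₀, h1⟩ := mem_nhds_iff.mp (Filter.mem_map.mp hS)
    -- `T` is an open set of `G` whose trace on `parMinus α` is the preimage of `T₀`; it contains
    -- `ik α` because `T₀` contains the identity.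
    obtain ⟨T, hT, hTT₀⟩ := isOpen_induced_iff.mp
      (hT₀.preimage (QuotientGroup.continuous_mk (N := ikInParMinus α)))
    have hmem : ∀ y : parMinus α, (y : G) ∈ T ↔ (y : parMinus α ⧸ ikInParMinus α) ∈ T₀ :=
      fun y => Set.ext_iff.mp hTT₀ y
    have hik : (ik α : Set G) ⊆ T := by
      intro y hy
      refine (hmem ⟨y, ik_le_parMinus α hy⟩).mpr ?_
      rwa [(QuotientGroup.eq_one_iff (N := ikInParMinus α) ⟨y, ik_le_parMinus α hy⟩).mpr hy]
    obtain ⟨N, hN, hNT⟩ := exists_nhds_forall_exists_map_eq α hT hik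
    have hN' : (QuotientGroup.mk : parMinus α → parMinus α ⧸ ikInParMinus α) ''
        (Subtype.val ⁻¹' N) ∈ 𝓝 (1 : parMinus α ⧸ ikInParMinus α) :=
      QuotientGroup.isOpenMap_coe.image_mem_nhds
        (continuous_subtype_val.continuousAt.preimage_mem_nhds
          (show N ∈ 𝓝 ((1 : parMinus α) : G) from hN))
    refine Filter.mem_of_superset hN' ?_
    rintro _ ⟨x, hx, rfl⟩
    obtain ⟨y, hy, hyT, hyx⟩ := hNT x hx x.2
    have := hT₀S ((hmem ⟨y, hy⟩).mp hyT)
    rwa [Set.mem_preimage, show f ((⟨y, hy⟩ : parMinus α) : parMinus α ⧸ ikInParMinus α) =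
      (x : parMinus α ⧸ ikInParMinus α) from congrArg _ (Subtype.ext hyx)] at this
  · rw [injective_iff_map_eq_one]
    intro q
    obtain ⟨y, rfl⟩ := QuotientGroup.mk_surjective q
    intro hq
    have hy : α y ∈ ik α := (QuotientGroup.eq_one_iff (N := ikInParMinus α) _).mp hq
    exact (QuotientGroup.eq_one_iff _).mpr ((map_mem_ik_iff y.2).mp hy)
  · intro q
    obtain ⟨⟨x, u, hu, hub⟩, rfl⟩ := QuotientGroup.mk_surjective q
    have hu1 : u 1 ∈ parMinus α := by
      refine ⟨_, hu.shift 1, IsCompact.closure_of_subset hub ?_⟩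
      rintro _ ⟨n, rfl⟩
      exact subset_closure ⟨_, rfl⟩
    refine ⟨QuotientGroup.mk ⟨u 1, hu1⟩, congrArg QuotientGroup.mk (Subtype.ext ?_)⟩
    exact (hu.succ 0).trans hu.zero

end Nub

end Endo

theorem mainTheorem9 {G : Type*} [Group G] [TopologicalSpace G] [IsTopologicalGroup G]
    [LocallyCompactSpace G] [TotallyDisconnectedSpace G] (α : G →ₜ* G) :
    -- the chain of inclusions
    (Endo.ik α ≤ Endo.nub α ∧ Endo.nub α ≤ Endo.lev α) ∧
    -- stability
    (Endo.IsStable α (Endo.ik α) ∧ Endo.IsStable α (Endo.nub α) ∧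
      Endo.IsStable α (Endo.lev α)) ∧
    -- compactness
    (IsCompact (Endo.nub α : Set G) ∧ IsCompact (Endo.ik α : Set G)) ∧
    -- normality in the anti-parabolic subgroup; the induced map on the quotient is
    -- an isomorphism of topological groups
    (Endo.ik α ≤ Endo.parMinus α ∧
      ∃ (_ : (Endo.ikInParMinus α).Normal)
        (h : Endo.ikInParMinus α ≤ (Endo.ikInParMinus α).comap (Endo.parMinusHom α)),
        IsHomeomorph (QuotientGroup.map (Endo.ikInParMinus α) (Endo.ikInParMinus α)
          (Endo.parMinusHom α) h)) ∧
    -- the subgroup obtained by taking the closure before intersecting with the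
    -- anti-parabolic subgroup
    (Endo.ik α ≤ (Endo.iteratedKernel α).topologicalClosure ⊓ Endo.parMinus α ∧
      (Endo.iteratedKernel α).topologicalClosure ⊓ Endo.parMinus α ≤ Endo.nub α ∧
      Endo.IsInvariant α ((Endo.iteratedKernel α).topologicalClosure ⊓ Endo.parMinus α) ∧
      IsCompact (((Endo.iteratedKernel α).topologicalClosure ⊓ Endo.parMinus α : Subgroup G) :
        Set G) ∧
      (((Endo.iteratedKernel α).topologicalClosure ⊓ Endo.parMinus α).subgroupOf
        (Endo.parMinus α)).Normal) := by
  refine ⟨⟨Endo.ik_le_nub α, Endo.nub_le_lev α⟩,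
    ⟨Endo.isStable_ik α, Endo.isStable_nub α, Endo.isStable_lev α⟩,
    ⟨Endo.isCompact_nub α, Endo.isCompact_ik α⟩,
    ⟨Endo.ik_le_parMinus α, Endo.normal_ikInParMinus α, Endo.ikInParMinus_le_comap α, ?_⟩,
    Endo.ik_le_topologicalClosure_inf_parMinus α,
    Endo.topologicalClosure_iteratedKernel_inf_parMinus_le_nub α,
    Endo.isInvariant_topologicalClosure_iteratedKernel_inf_parMinus α,
    Endo.isCompact_topologicalClosure_iteratedKernel_inf_parMinus α,
    Endo.normal_subgroupOf_topologicalClosure_iteratedKernel_inf_parMinus α⟩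
  have := Endo.normal_ikInParMinus α
  exact Endo.isHomeomorph_quotientMap α
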